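/- Let $E$ be an infinite-dimensional real Banach space. Suppose that $E$ admits an equivalent norm $N$ that is strictly convex and of class $C^1$ on $E\setminus\{0\}$, and that $E$ has a Schauder basis $\{e_n\}_{n\in\mathbb{N}}$ which is $1$-suppression unconditional for $N$, that is, for every $x=\sum_{j}x_je_j\in E$ and every $j_0\in\mathbb{N}$, $$N\Big(\sum_{j\neq j_0}x_je_j\Big)\le N\Big(\sum_{j}x_je_j\Big).$$ Let $U\subseteq E$ be open, let $d$ be a natural number, and give $\mathbb{R}^d$ the Euclidean norm. Let $f:U\to\mathbb{R}^d$ be a $C^1$ map and $\varepsilon:U\to(0,\infty)$ a continuous function. Then there exists a $C^1$ map $g:U\to\mathbb{R}^d$ such that 1. $\|f(x)-g(x)\|\le\varepsilon(x)$ for every $x\in U$; 2. $\|Df(x)-Dg(x)\|\le\varepsilon(x)$ for every $x\in U$ (operator norm); 3. the critical set $C_g=\{x\in U: Dg(x):E\to\mathbb{R}^d\text{ is not surjective}\}$ is locally contained in a finite union of complemented subspaces of infinite codimension in $E$: for every $x\in C_g$ there are an open neighbourhood $V$ of $x$ and finitely many closed subspaces $E_1,\dots,E_n$ of $E$, each complemented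 in $E$ and of infinite codimension, with $C_g\cap V\subseteq\bigcup_{j=1}^{n}E_j$. -/

import Mathlib

/-- `N` is a norm on `E` that is equivalent to the given norm of `E`. -/
def IsEquivalentNorm {E : Type*} [NormedAddCommGroup E] [NormedSpace ℝ E]
    (N : Seminorm ℝ E) : Prop :=
  ∃ c C : ℝ, 0 < c ∧ 0 < C ∧ ∀ x : E, c * ‖x‖ ≤ N x ∧ N x ≤ C * ‖x‖

/-- The norm `N` is of class `C¹` (away from the origin, where no norm is differentiable). -/
def IsC1Norm {E : Type*} [NormedAddCommGroup E] [NormedSpace ℝ E]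
    (N : Seminorm ℝ E) : Prop :=
  ContDiffOn ℝ 1 (fun x : E => N x) {x : E | x ≠ 0}

/-- The norm `N` is strictly convex: the midpoint of two distinct unit vectors has norm `< 1`. -/
def IsStrictlyConvexNorm {E : Type*} [NormedAddCommGroup E] [NormedSpace ℝ E]
    (N : Seminorm ℝ E) : Prop :=
  ∀ x y : E, N x = 1 → N y = 1 → x ≠ y → N ((1 / 2 : ℝ) • (x + y)) < 1

/-- The Schauder basis `b` is `1`-suppression unconditional for the norm `N`: deleting one term
from the expansion of a vector does not increase its norm. -/
def IsOneSuppressionUnconditional {E : Type*} [NormedAddCommGroup E] [NormedSpace ℝ E]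
    (N : Seminorm ℝ E) (b : SchauderBasis ℝ E) : Prop :=
  ∀ (x : E) (j : ℕ), N (x - b.coord j x • b j) ≤ N x

/-- The critical set of `g` in the open set `U`. -/
def criticalSet {E F : Type*} [NormedAddCommGroup E] [NormedSpace ℝ E]
    [NormedAddCommGroup F] [NormedSpace ℝ F] (g : E → F) (U : Set E) : Set E :=
  {x : E | x ∈ U ∧ ¬ Function.Surjective (fderiv ℝ g x)}

/-- `X` is locally contained in a finite union of complemented subspaces of infinite codimension:
every point of `X` has an open neighbourhood `V` such that `X ∩ V` is contained in a finite union
of closed subspaces of `E` that are complemented in `E` and have infinite codimension. -/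
def LocallyInFiniteUnionOfComplemented {E : Type*} [NormedAddCommGroup E] [NormedSpace ℝ E]
    (X : Set E) : Prop :=
  ∀ x ∈ X, ∃ V : Set E, IsOpen V ∧ x ∈ V ∧
    ∃ (n : ℕ) (S : Fin n → Submodule ℝ E),
      (∀ i, IsClosed (S i : Set E) ∧ (S i).ClosedComplemented ∧
        ¬ FiniteDimensional ℝ (E ⧸ S i)) ∧
      X ∩ V ⊆ ⋃ i, (S i : Set E)

/-!
The map `f` is precomposed with a nonlinear projection that freezes the partial sums of `x` once
the tail of `x` is small relative to a radius `τ` adapted to `f` and `ε`. A `C¹` norm forces the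
unconditional basis to be shrinking, so `Df` is small on far tails and freezing moves `f` little
in the `C¹` sense. Near a given point only finitely many coordinates survive the freezing, and a
small series of gated terms `xⱼ wⱼ` is added, where `(wⱼ)` is bounded, has total tails and vanishes
infinitely often. If some functional `φ ≠ 0` annihilates the range of the derivative at `x`, then
testing on the basis vectors `eⱼ` with `j` large forces `φ (wⱼ)` to be proportional, with a nonzero
constant, to the derivative of the norm of a tail of `x` in the direction `eⱼ`. Where `wⱼ = 0` this
derivative vanishes, and strict convexity then gives `xⱼ = 0`. So the critical points near a given
one lie in a subspace `{x | xⱼ = 0 for j ≥ K with wⱼ = 0}`, which unconditionality complements.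
-/

open Filter Topology Set

section Coordinates

variable {𝕜 E : Type*} [NontriviallyNormedField 𝕜] [NormedAddCommGroup E] [NormedSpace 𝕜 E]
  (b : SchauderBasis 𝕜 E)

theorem coord_basis_self (j : ℕ) : b.coord j (b j) = 1 := by
  simp [b.ortho]

theorem coord_basis_of_ne {i j : ℕ} (h : i ≠ j) : b.coord i (b j) = 0 := by
  simp [b.ortho, h]

theorem coord_proj (j k : ℕ) (x : E) :
    b.coord j (b.proj k x) = if j < k then b.coord j x else 0 := by
  simp [SchauderBasis.proj_apply, b.ortho, Pi.single_apply]

theorem coord_sum_smul (s : Finset ℕ) (a : ℕ → 𝕜) (j : ℕ) :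
    b.coord j (∑ l ∈ s, a l • b l) = if j ∈ s then a j else 0 := by
  simp [b.ortho, Pi.single_apply]

/-- The tail projection `x ↦ ∑ j ≥ k, x_j b_j` of a Schauder basis `b`. -/
noncomputable def tailProj (k : ℕ) : E →L[𝕜] E :=
  ContinuousLinearMap.id 𝕜 E - b.proj k

theorem tailProj_apply (k : ℕ) (x : E) : tailProj b k x = x - b.proj k x := rfl

theorem coord_tailProj (j k : ℕ) (x : E) :
    b.coord j (tailProj b k x) = if k ≤ j then b.coord j x else 0 := by
  rw [tailProj_apply, map_sub, coord_proj]
  by_cases h : j < k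
  · simp [h]
  · simp [h, not_lt.1 h]

theorem tailProj_basis_of_lt {j k : ℕ} (h : j < k) : tailProj b k (b j) = 0 := by
  rw [tailProj_apply, SchauderBasis.proj_apply_basis_mem, if_pos h, sub_self]

theorem tailProj_basis_of_le {j k : ℕ} (h : k ≤ j) : tailProj b k (b j) = b j := by
  rw [tailProj_apply, SchauderBasis.proj_apply_basis_mem, if_neg h.not_gt, sub_zero]

theorem tailProj_succ (k : ℕ) (x : E) :
    tailProj b (k + 1) x = tailProj b k x - b.coord k x • b k := by
  rw [tailProj_apply, tailProj_apply, SchauderBasis.proj_apply, SchauderBasis.proj_apply,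
    Finset.sum_range_succ]
  abel

theorem mem_range_proj_iff {k : ℕ} {x : E} :
    x ∈ (b.proj k).range ↔ tailProj b k x = 0 := by
  rw [tailProj_apply, sub_eq_zero]
  refine ⟨?_, fun h => ⟨x, h.symm⟩⟩
  rintro ⟨y, rfl⟩
  have hidem := SchauderBasis.proj_comp b k k y
  rw [min_self] at hidem
  exact hidem.symm

theorem tailProj_tailProj {k l : ℕ} (h : k ≤ l) (x : E) :
    tailProj b l (tailProj b k x) = tailProj b l x := by
  simp only [tailProj_apply, map_sub, SchauderBasis.proj_comp, min_eq_right h]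
  abel

theorem tendsto_tailProj (x : E) : Tendsto (fun k => tailProj b k x) atTop (𝓝 0) := by
  simpa [tailProj_apply] using (SchauderBasis.tendsto_proj b x).const_sub x

end Coordinates

section Suppression

variable {E : Type*} [NormedAddCommGroup E] [NormedSpace ℝ E] {N : Seminorm ℝ E}
  {b : SchauderBasis ℝ E}

theorem IsEquivalentNorm.continuous (hN : IsEquivalentNorm N) : Continuous N := by
  obtain ⟨c, C, _, hC, h⟩ := hN
  refine Seminorm.continuous_of_le (q := C.toNNReal • normSeminorm ℝ E) ?_ fun x => ?_
  · exact continuous_norm.const_smul C.toNNReal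
  · simpa [NNReal.smul_def, hC.le] using (h x).2

theorem IsEquivalentNorm.pos (hN : IsEquivalentNorm N) {x : E} (hx : x ≠ 0) : 0 < N x := by
  obtain ⟨c, C, hc, _, h⟩ := hN
  exact (mul_pos hc (norm_pos_iff.2 hx)).trans_le (h x).1

namespace IsOneSuppressionUnconditional

variable (hb : IsOneSuppressionUnconditional N b)
include hb

theorem sub_smul_le (x : E) (j : ℕ) {a : ℝ} (h0 : 0 ≤ a) (h1 : a ≤ 1) :
    N (x - (a * b.coord j x) • b j) ≤ N x := by
  calc N (x - (a * b.coord j x) • b j)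
      = N ((1 - a) • x + a • (x - b.coord j x • b j)) := by congr 1; module
    _ ≤ (1 - a) * N x + a * N (x - b.coord j x • b j) := by
        refine (map_add_le_add N _ _).trans_eq ?_
        rw [map_smul_eq_mul, map_smul_eq_mul, Real.norm_of_nonneg h0,
          Real.norm_of_nonneg (sub_nonneg.2 h1)]
    _ ≤ (1 - a) * N x + a * N x := by gcongr; exact hb x j
    _ = N x := by ring

theorem sub_sum_le (s : Finset ℕ) {a : ℕ → ℝ} (h0 : ∀ l ∈ s, 0 ≤ a l) (h1 : ∀ l ∈ s, a l ≤ 1)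
    (x : E) : N (x - ∑ l ∈ s, (a l * b.coord l x) • b l) ≤ N x := by
  classical
  induction s using Finset.induction_on with
  | empty => simp
  | insert j s hj ih =>
    set z := x - ∑ l ∈ s, (a l * b.coord l x) • b l with hz
    have hzj : b.coord j z = b.coord j x := by
      rw [hz, map_sub, coord_sum_smul, if_neg hj, sub_zero]
    have hsum : x - ∑ l ∈ insert j s, (a l * b.coord l x) • b l
        = z - (a j * b.coord j z) • b j := by
      rw [Finset.sum_insert hj, hzj, hz]; abel
    rw [Finset.forall_mem_insert] at h0 h1
    rw [hsum]
    exact (hb.sub_smul_le z j h0.1 h1.1).trans (ih h0.2 h1.2)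

theorem tailProj_le (k : ℕ) (x : E) : N (tailProj b k x) ≤ N x := by
  simpa [tailProj_apply, SchauderBasis.proj_apply] using
    hb.sub_sum_le (Finset.range k) (a := fun _ => 1) (by simp) (by simp) x

theorem tailProj_anti {k l : ℕ} (h : k ≤ l) (x : E) :
    N (tailProj b l x) ≤ N (tailProj b k x) := by
  rw [← tailProj_tailProj b h]
  exact hb.tailProj_le l _

variable (hN : Continuous N)
include hN

theorem sum_le_tailProj (s : Finset ℕ) {a : ℕ → ℝ} {k : ℕ} (hk : ∀ l ∈ s, l < k → a l = 0)
    (h0 : ∀ l ∈ s, 0 ≤ a l) (h1 : ∀ l ∈ s, a l ≤ 1) (x : E) :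
    N (∑ l ∈ s, (a l * b.coord l x) • b l) ≤ N (tailProj b k x) := by
  classical
  set y := tailProj b k x with hy
  set S := ∑ l ∈ s, (a l * b.coord l y) • b l with hS
  have hxy : ∑ l ∈ s, (a l * b.coord l x) • b l = S := Finset.sum_congr rfl fun l hl => by
    rcases lt_or_ge l k with h | h
    · rw [hk l hl h, zero_mul, zero_mul]
    · rw [hy, coord_tailProj, if_pos h]
  obtain ⟨n₀, hn₀⟩ := s.exists_nat_subset_range
  have hlim : Tendsto (fun n => N (S + tailProj b n y)) atTop (𝓝 (N S)) := by
    have := (tendsto_tailProj b y).const_add S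
    rw [add_zero] at this
    exact (hN.tendsto S).comp this
  rw [hxy]
  refine le_of_tendsto hlim (eventually_atTop.2 ⟨n₀, fun n hn => ?_⟩)
  have hsn : s ⊆ Finset.range n := hn₀.trans (Finset.range_subset_range.2 hn)
  have hrw : S + tailProj b n y
      = y - ∑ l ∈ Finset.range n, ((1 - if l ∈ s then a l else 0) * b.coord l y) • b l := by
    simp only [hS, tailProj_apply, SchauderBasis.proj_apply, sub_mul, sub_smul, one_mul, ite_mul,
      zero_mul, ite_smul, zero_smul, Finset.sum_sub_distrib, Finset.sum_ite_mem,
      Finset.inter_eq_right.2 hsn]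
    abel
  rw [hrw]
  refine hb.sub_sum_le _ (fun l _ => ?_) (fun l _ => ?_) y <;> split_ifs with h
  · exact sub_nonneg.2 (h1 l h)
  · simp
  · exact sub_le_self _ (h0 l h)
  · simp

theorem sum_le_mul_tailProj (s : Finset ℕ) {a : ℕ → ℝ} {k : ℕ}
    (hk : ∀ l ∈ s, l < k → a l = 0) {M : ℝ} (h0 : ∀ l ∈ s, 0 ≤ a l) (hM : ∀ l ∈ s, a l ≤ M)
    (hM0 : 0 ≤ M) (x : E) :
    N (∑ l ∈ s, (a l * b.coord l x) • b l) ≤ M * N (tailProj b k x) := by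
  have hscale : ∑ l ∈ s, (a l * b.coord l x) • b l
      = M • ∑ l ∈ s, (a l / M * b.coord l x) • b l := by
    rw [Finset.smul_sum]
    refine Finset.sum_congr rfl fun l hl => ?_
    rw [smul_smul, ← mul_assoc, mul_div_cancel_of_imp' fun h => ?_]
    exact le_antisymm (h ▸ hM l hl) (h0 l hl)
  rw [hscale, map_smul_eq_mul, Real.norm_of_nonneg hM0]
  gcongr
  exact hb.sum_le_tailProj hN s (fun l hl h => by rw [hk l hl h, zero_div])
    (fun l hl => div_nonneg (h0 l hl) hM0) (fun l hl => div_le_one_of_le₀ (hM l hl) hM0) x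

theorem sum_le_of_abs_le (s : Finset ℕ) {a : ℕ → ℝ} {k : ℕ} (hk : ∀ l ∈ s, l < k → a l = 0)
    {M : ℝ} (hM : ∀ l ∈ s, |a l| ≤ M) (hM0 : 0 ≤ M) (x : E) :
    N (∑ l ∈ s, (a l * b.coord l x) • b l) ≤ 2 * M * N (tailProj b k x) := by
  have hsplit : ∑ l ∈ s, (a l * b.coord l x) • b l = ∑ l ∈ s, ((a l)⁺ * b.coord l x) • b l
      - ∑ l ∈ s, ((a l)⁻ * b.coord l x) • b l := by
    rw [← Finset.sum_sub_distrib]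
    exact Finset.sum_congr rfl fun l _ => by rw [← sub_smul, ← sub_mul, posPart_sub_negPart]
  have hpos := hb.sum_le_mul_tailProj hN s (a := fun l => (a l)⁺) (k := k)
    (fun l hl h => by simp [hk l hl h]) (fun l _ => posPart_nonneg _)
    (fun l hl => (sup_le (le_abs_self _) (abs_nonneg _)).trans (hM l hl)) hM0 x
  have hneg := hb.sum_le_mul_tailProj hN s (a := fun l => (a l)⁻) (k := k)
    (fun l hl h => by simp [hk l hl h]) (fun l _ => negPart_nonneg _)
    (fun l hl => (sup_le (neg_le_abs _) (abs_nonneg _)).trans (hM l hl)) hM0 x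
  rw [hsplit]
  linarith [map_sub_le_add N (∑ l ∈ s, ((a l)⁺ * b.coord l x) • b l)
    (∑ l ∈ s, ((a l)⁻ * b.coord l x) • b l)]

theorem abs_coord_mul_le {j k : ℕ} (h : k ≤ j) (x : E) :
    |b.coord j x| * N (b j) ≤ N (tailProj b k x) := by
  simpa [map_smul_eq_mul] using
    hb.sum_le_tailProj hN {j} (a := fun _ => 1) (k := k) (by simp [h]) (by simp) (by simp) x

end IsOneSuppressionUnconditional

end Suppression

section Ekeland

variable {X : Type*} [MetricSpace X] {J : X → ℝ} {δ : ℝ} {x y : X}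

/-- The points to which `J` descends from `x` with slope at least `δ`. -/
def descentSet (J : X → ℝ) (δ : ℝ) (x : X) : Set X :=
  {y | J y + δ * dist x y ≤ J x}

theorem self_mem_descentSet : x ∈ descentSet J δ x := by
  simp [descentSet]

theorem descentSet_subset (hδ : 0 < δ) (hy : y ∈ descentSet J δ x) :
    descentSet J δ y ⊆ descentSet J δ x := by
  intro z (hz : J z + δ * dist y z ≤ J y)
  change J y + δ * dist x y ≤ J x at hy
  change J z + δ * dist x z ≤ J x
  linarith [mul_le_mul_of_nonneg_left (dist_triangle x y z) hδ.le]

theorem isClosed_descentSet (hJ : LowerSemicontinuous J) (x : X) :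
    IsClosed (descentSet J δ x) := by
  have hdist : Continuous fun y => δ * dist x y := by fun_prop
  exact (hJ.add hdist.lowerSemicontinuous).isClosed_preimage (J x)

theorem exists_mem_descentSet_forall_le_add (hJ : BddBelow (range J)) {η : ℝ} (hη : 0 < η)
    (x : X) : ∃ z ∈ descentSet J δ x, ∀ y ∈ descentSet J δ x, J z ≤ J y + η := by
  have hne : (J '' descentSet J δ x).Nonempty := ⟨J x, x, self_mem_descentSet, rfl⟩
  obtain ⟨_, ⟨z, hz, rfl⟩, hzη⟩ := Real.lt_sInf_add_pos hne hη
  refine ⟨z, hz, fun y hy => hzη.le.trans ?_⟩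
  gcongr
  exact csInf_le (hJ.mono (image_subset_range _ _)) (mem_image_of_mem J hy)

/-- Ekeland's variational principle, in its weak form. -/
theorem exists_forall_le_add_mul_dist [CompleteSpace X] [Nonempty X]
    (hJ : LowerSemicontinuous J) (hbdd : BddBelow (range J)) (hδ : 0 < δ) :
    ∃ x, ∀ y, J x ≤ J y + δ * dist x y := by
  choose next next_mem next_le using fun n : ℕ =>
    exists_mem_descentSet_forall_le_add (δ := δ) hbdd (pow_pos (one_half_pos (α := ℝ)) n)
  obtain ⟨x₀⟩ := ‹Nonempty X›
  let u : ℕ → X := fun n => Nat.rec x₀ next n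
  have hanti : Antitone fun n => descentSet J δ (u n) :=
    antitone_nat_of_succ_le fun n => descentSet_subset hδ (next_mem n (u n))
  have hdist : ∀ n, ∀ y ∈ descentSet J δ (u (n + 1)), dist (u (n + 1)) y ≤ (1 / 2) ^ n / δ := by
    intro n y hy
    rw [le_div_iff₀' hδ]
    have hlow : J (u (n + 1)) ≤ J y + (1 / 2) ^ n := next_le n (u n) y (hanti n.le_succ hy)
    change J y + δ * dist (u (n + 1)) y ≤ J (u (n + 1)) at hy
    linarith
  have hρ : Tendsto (fun n : ℕ => (1 / 2 : ℝ) ^ n / δ) atTop (𝓝 0) := by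
    simpa using (tendsto_pow_atTop_nhds_zero_of_lt_one (r := (1 / 2 : ℝ)) (by norm_num)
      (by norm_num)).div_const δ
  have hmem : ∀ {n m}, n ≤ m → u m ∈ descentSet J δ (u n) := fun h =>
    hanti h self_mem_descentSet
  have hcauchy : CauchySeq fun n => u (n + 1) := by
    refine cauchySeq_of_le_tendsto_0' (fun n => (1 / 2) ^ n / δ) (fun n m hnm => ?_) hρ
    exact hdist n _ (hmem (Nat.succ_le_succ hnm))
  obtain ⟨x, hx⟩ := cauchySeq_tendsto_of_complete hcauchy
  have hxS : ∀ n, x ∈ descentSet J δ (u n) := fun n =>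
    (isClosed_descentSet hJ _).mem_of_tendsto hx <| eventually_atTop.2
      ⟨n, fun m hm => hmem (hm.trans m.le_succ)⟩
  refine ⟨x, fun y => ?_⟩
  by_contra! hy
  have hyS : ∀ n, y ∈ descentSet J δ (u n) := fun n => descentSet_subset hδ (hxS n) hy.le
  have hyx : Tendsto (fun n => u (n + 1)) atTop (𝓝 y) := tendsto_iff_dist_tendsto_zero.2 <|
    squeeze_zero (fun _ => dist_nonneg) (fun n => hdist n y (hyS (n + 1))) hρ
  simp [tendsto_nhds_unique hyx hx] at hy

end Ekeland

section DirectionalBounds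

variable {E : Type*} [NormedAddCommGroup E] [NormedSpace ℝ E] {f : E → ℝ} {f' : E →L[ℝ] ℝ}
  {x : E} {L : ℝ}

theorem apply_le_of_hasFDerivAt_of_sub_le (h : HasFDerivAt f f' x) {v : E}
    (hL : ∀ᶠ s : ℝ in 𝓝[>] 0, f (x + s • v) - f x ≤ s * L) : f' v ≤ L := by
  refine le_of_tendsto (h.hasLineDerivAt v).tendsto_slope_zero_right ?_
  filter_upwards [hL, self_mem_nhdsWithin] with s hs (hs0 : 0 < s)
  rwa [smul_eq_mul, inv_mul_le_iff₀ hs0]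

theorem abs_apply_le_of_hasFDerivAt_of_sub_le {N : Seminorm ℝ E} (h : HasFDerivAt f f' x)
    (hL : ∀ v, f (x + v) - f x ≤ L * N v) (v : E) : |f' v| ≤ L * N v := by
  have hle : ∀ v, f' v ≤ L * N v := fun v => apply_le_of_hasFDerivAt_of_sub_le h <| by
    filter_upwards [self_mem_nhdsWithin] with s (hs : 0 < s)
    refine (hL _).trans_eq ?_
    rw [map_smul_eq_mul, Real.norm_of_nonneg hs.le]; ring
  exact abs_le'.2 ⟨hle v, by simpa using hle (-v)⟩

end DirectionalBounds

section Shrinking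

variable {E : Type*} [NormedAddCommGroup E] [NormedSpace ℝ E]

/-- Ekeland's principle gives almost minimisers of `g - φ` at which the derivative is small. -/
theorem exists_norm_sub_fderiv_le [CompleteSpace E] {g : E → ℝ} (hg : Differentiable ℝ g) {c : ℝ}
    (hc : 0 < c) (hgc : ∀ x, c * ‖x‖ ^ 2 ≤ g x) (φ : E →L[ℝ] ℝ) {δ : ℝ} (hδ : 0 < δ) :
    ∃ x, ‖φ - fderiv ℝ g x‖ ≤ δ := by
  have hbdd : BddBelow (range fun x => g x - φ x) := by
    refine ⟨-(‖φ‖ ^ 2 / (4 * c)), ?_⟩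
    rintro _ ⟨x, rfl⟩
    have hφ : φ x ≤ ‖φ‖ * ‖x‖ := (le_abs_self _).trans (φ.le_opNorm x)
    have hsq : ‖φ‖ ^ 2 / (4 * c) + c * ‖x‖ ^ 2 - ‖φ‖ * ‖x‖ = (‖φ‖ - 2 * c * ‖x‖) ^ 2 / (4 * c) := by
      field_simp; ring
    have hsq0 : 0 ≤ (‖φ‖ - 2 * c * ‖x‖) ^ 2 / (4 * c) := by positivity
    linarith [hgc x]
  obtain ⟨x, hx⟩ := exists_forall_le_add_mul_dist
    (hg.continuous.sub φ.continuous).lowerSemicontinuous hbdd hδ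
  have hderiv : HasFDerivAt (fun x => φ x - g x) (φ - fderiv ℝ g x) x :=
    φ.hasFDerivAt.sub (hg x).hasFDerivAt
  refine ⟨x, ContinuousLinearMap.opNorm_le_bound _ hδ.le fun v => ?_⟩
  refine abs_apply_le_of_hasFDerivAt_of_sub_le (N := normSeminorm ℝ E) hderiv (fun w => ?_) v
  have hxw := hx (x + w)
  rw [dist_self_add_right] at hxw
  simp only [Pi.sub_apply] at hxw
  rw [coe_normSeminorm]
  linarith

variable {N : Seminorm ℝ E} {b : SchauderBasis ℝ E}

theorem norm_fderiv_seminorm_le {C : ℝ} (hC0 : 0 ≤ C) (hC : ∀ x, N x ≤ C * ‖x‖) (x : E) :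
    ‖fderiv ℝ N x‖ ≤ C := by
  by_cases hd : DifferentiableAt ℝ N x
  · refine ContinuousLinearMap.opNorm_le_bound _ hC0 fun v => ?_
    have hv : |fderiv ℝ N x v| ≤ 1 * N v :=
      abs_apply_le_of_hasFDerivAt_of_sub_le hd.hasFDerivAt
        (fun w => by linarith [map_add_le_add N x w]) v
    exact hv.trans (by linarith [hC v])
  · rwa [fderiv_zero_of_not_differentiableAt hd, norm_zero]

theorem hasFDerivAt_seminorm_sq_zero {C : ℝ} (hC : ∀ x, N x ≤ C * ‖x‖) :
    HasFDerivAt (fun x => N x ^ 2) (0 : E →L[ℝ] ℝ) 0 := by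
  rw [hasFDerivAt_iff_isLittleO_nhds_zero]
  have hO : (fun v : E => N v ^ 2) =O[𝓝 0] fun v : E => ‖v‖ ^ 2 := by
    refine Asymptotics.IsBigO.of_bound (C ^ 2) (Eventually.of_forall fun v => ?_)
    rw [Real.norm_of_nonneg (by positivity), Real.norm_of_nonneg (by positivity), ← mul_pow]
    exact pow_le_pow_left₀ (apply_nonneg N v) (hC v) 2
  simpa using hO.trans_isLittleO (Asymptotics.isLittleO_norm_pow_id one_lt_two)

theorem IsC1Norm.contDiffAt (hC1 : IsC1Norm N) {x : E} (hx : x ≠ 0) : ContDiffAt ℝ 1 N x :=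
  ContDiffOn.contDiffAt hC1 (isOpen_ne.mem_nhds hx)

theorem IsC1Norm.contDiff_sq (hC1 : IsC1Norm N) (hN : IsEquivalentNorm N) :
    ContDiff ℝ 1 (fun x => N x ^ 2) := by
  obtain ⟨_, C, _, hC0, h⟩ := hN
  have hzero : HasFDerivAt (fun x => N x ^ 2) (0 : E →L[ℝ] ℝ) 0 :=
    hasFDerivAt_seminorm_sq_zero fun x => (h x).2
  rw [contDiff_one_iff_fderiv, continuous_iff_continuousAt, Differentiable, ← forall_and]
  intro x
  rcases eq_or_ne x 0 with rfl | hx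
  · refine ⟨hzero.differentiableAt, ?_⟩
    have hbound : ∀ x : E, ‖fderiv ℝ (fun x => N x ^ 2) x‖ ≤ 2 * C * (C * ‖x‖) := by
      intro x
      rcases eq_or_ne x 0 with rfl | hx
      · simp [hzero.fderiv]
      · have hd := (hC1.contDiffAt hx).differentiableAt one_ne_zero
        rw [(hd.hasFDerivAt.pow 2).fderiv, norm_smul]
        simp only [nsmul_eq_mul, Nat.cast_ofNat, Nat.add_one_sub_one, pow_one, norm_mul,
          Real.norm_ofNat, Real.norm_of_nonneg (apply_nonneg N x)]
        calc 2 * N x * ‖fderiv ℝ N x‖ ≤ 2 * (C * ‖x‖) * C := by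
              gcongr
              exacts [(h x).2, norm_fderiv_seminorm_le hC0.le (fun x => (h x).2) x]
          _ = 2 * C * (C * ‖x‖) := by ring
    have hlim : Tendsto (fun x : E => 2 * C * (C * ‖x‖)) (𝓝 0) (𝓝 0) :=
      Continuous.tendsto' (by fun_prop) _ _ (by simp)
    rw [ContinuousAt, hzero.fderiv]
    exact squeeze_zero_norm hbound hlim
  · have hsq : ContDiffAt ℝ 1 (fun x => N x ^ 2) x := (hC1.contDiffAt hx).pow 2
    exact ⟨hsq.differentiableAt one_ne_zero, hsq.continuousAt_fderiv one_ne_zero⟩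

theorem IsOneSuppressionUnconditional.proj_le (hb : IsOneSuppressionUnconditional N b)
    (hN : Continuous N) (k : ℕ) (x : E) : N (b.proj k x) ≤ N x := by
  refine le_trans ?_ (hb.tailProj_le 0 x)
  simpa [SchauderBasis.proj_apply] using
    hb.sum_le_tailProj hN (Finset.range k) (a := fun _ => 1) (k := 0) (by simp) (by simp)
      (by simp) x

/-- By suppression, `N` is minimal at `P_k x` along the directions in the tail. -/
theorem IsOneSuppressionUnconditional.fderiv_sq_proj_tailProj
    (hb : IsOneSuppressionUnconditional N b) (hN : Continuous N)
    (hd : Differentiable ℝ fun x => N x ^ 2) (k : ℕ) (x v : E) :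
    fderiv ℝ (fun x => N x ^ 2) (b.proj k x) (tailProj b k v) = 0 := by
  have hline := (hd (b.proj k x)).hasFDerivAt.hasLineDerivAt (tailProj b k v)
  refine IsLocalMin.hasDerivAt_eq_zero (Eventually.of_forall fun t => ?_) hline
  have hproj : b.proj k (b.proj k x + t • tailProj b k v) = b.proj k x := by
    simp only [tailProj_apply, map_add, map_smul, map_sub, SchauderBasis.proj_comp, min_self,
      sub_self, smul_zero, add_zero]
  have hle := hb.proj_le hN k (b.proj k x + t • tailProj b k v)
  rw [hproj] at hle
  simpa using pow_le_pow_left₀ (apply_nonneg N _) hle 2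

theorem IsOneSuppressionUnconditional.tendsto_comp_tailProj_dual [CompleteSpace E]
    (hb : IsOneSuppressionUnconditional N b) (hN : IsEquivalentNorm N) (hC1 : IsC1Norm N)
    (φ : E →L[ℝ] ℝ) : Tendsto (fun k => φ.comp (tailProj b k)) atTop (𝓝 0) := by
  obtain ⟨M, hM⟩ := b.exists_norm_proj_le
  have hM0 : 0 ≤ M := (norm_nonneg _).trans (hM 0)
  obtain ⟨hdiff, hcont⟩ := contDiff_one_iff_fderiv.1 (hC1.contDiff_sq hN)
  have htail : ∀ k, ‖tailProj b k‖ ≤ 1 + M := fun k =>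
    norm_sub_le_of_le ContinuousLinearMap.norm_id_le (hM k)
  have hdense : ∀ δ > 0, ∃ x, ‖φ - fderiv ℝ (fun x => N x ^ 2) x‖ ≤ δ := by
    obtain ⟨c, _, hc, _, h⟩ := hN
    refine fun δ hδ => exists_norm_sub_fderiv_le hdiff (pow_pos hc 2) (fun x => ?_) φ hδ
    rw [← mul_pow]
    exact pow_le_pow_left₀ (by positivity) (h x).1 2
  rw [Metric.tendsto_nhds]
  intro e he
  obtain ⟨x, hx⟩ := hdense (e / (4 * (1 + M))) (by positivity)
  have hlim : Tendsto (fun k => ‖φ - fderiv ℝ (fun x => N x ^ 2) (b.proj k x)‖) atTop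
      (𝓝 ‖φ - fderiv ℝ (fun x => N x ^ 2) x‖) :=
    (((hcont.tendsto x).comp (SchauderBasis.tendsto_proj b x)).const_sub φ).norm
  have hlt : ‖φ - fderiv ℝ (fun x => N x ^ 2) x‖ < e / (2 * (1 + M)) :=
    hx.trans_lt (by gcongr; norm_num)
  filter_upwards [hlim.eventually_lt_const hlt] with k hk
  have hcomp : φ.comp (tailProj b k)
      = (φ - fderiv ℝ (fun x => N x ^ 2) (b.proj k x)).comp (tailProj b k) := by
    ext v
    simp only [ContinuousLinearMap.comp_apply, sub_apply,
      hb.fderiv_sq_proj_tailProj hN.continuous hdiff k x v, sub_zero]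
  rw [dist_zero_right, hcomp]
  calc _ ≤ ‖φ - fderiv ℝ (fun x => N x ^ 2) (b.proj k x)‖ * ‖tailProj b k‖ :=
        ContinuousLinearMap.opNorm_comp_le _ _
    _ ≤ e / (2 * (1 + M)) * (1 + M) := by gcongr; exact htail k
    _ < e := by field_simp; linarith

theorem IsOneSuppressionUnconditional.tendsto_comp_tailProj [CompleteSpace E] {F : Type*}
    [NormedAddCommGroup F] [NormedSpace ℝ F] [FiniteDimensional ℝ F]
    (hb : IsOneSuppressionUnconditional N b) (hN : IsEquivalentNorm N) (hC1 : IsC1Norm N)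
    (φ : E →L[ℝ] F) : Tendsto (fun k => φ.comp (tailProj b k)) atTop (𝓝 0) := by
  let v := Module.finBasis ℝ F
  let π := fun i => LinearMap.toContinuousLinearMap (v.coord i)
  have hsum : ∀ k, φ.comp (tailProj b k) = ∑ i, (ContinuousLinearMap.smulRightL ℝ E F).flip (v i)
      (((π i).comp φ).comp (tailProj b k)) := by
    intro k
    ext x
    simp [π, v.sum_repr]
  simp only [hsum]
  rw [← Finset.sum_const_zero (s := Finset.univ) (ι := Fin (Module.finrank ℝ F))]
  refine tendsto_finsetSum _ fun i _ => ?_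
  exact (ContinuousLinearMap.continuous _).tendsto' _ _ (map_zero _) |>.comp
    (hb.tendsto_comp_tailProj_dual hN hC1 ((π i).comp φ))

end Shrinking

section SmoothTransition

theorem hasDerivAt_smoothTransition (x : ℝ) :
    HasDerivAt Real.smoothTransition (deriv Real.smoothTransition x) x :=
  (Real.smoothTransition.contDiff.differentiable (n := 1) one_ne_zero x).hasDerivAt

theorem deriv_smoothTransition_of_nonpos {x : ℝ} (hx : x ≤ 0) :
    deriv Real.smoothTransition x = 0 :=
  IsLocalMin.deriv_eq_zero <| Eventually.of_forall fun y => by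
    simpa only [Real.smoothTransition.zero_of_nonpos hx] using Real.smoothTransition.nonneg y

theorem deriv_smoothTransition_of_one_le {x : ℝ} (hx : 1 ≤ x) :
    deriv Real.smoothTransition x = 0 :=
  IsLocalMax.deriv_eq_zero <| Eventually.of_forall fun y => by
    simpa only [Real.smoothTransition.one_of_one_le hx] using Real.smoothTransition.le_one y

theorem exists_abs_deriv_smoothTransition_le :
    ∃ c : ℝ, 1 ≤ c ∧ ∀ x, |deriv Real.smoothTransition x| ≤ c := by
  have hcont : Continuous (deriv Real.smoothTransition) :=
    Real.smoothTransition.contDiff.continuous_deriv (n := 1) le_rfl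
  have hsupp : HasCompactSupport (deriv Real.smoothTransition) := by
    refine HasCompactSupport.intro (isCompact_Icc (a := (0 : ℝ)) (b := 1)) fun x hx => ?_
    rw [mem_Icc, not_and_or, not_le, not_le] at hx
    exact hx.elim (fun h => deriv_smoothTransition_of_nonpos h.le)
      (fun h => deriv_smoothTransition_of_one_le h.le)
  obtain ⟨c, hc⟩ := hsupp.exists_bound_of_continuous hcont
  exact ⟨max c 1, le_max_right _ _, fun x => (hc x).trans (le_max_left _ _)⟩

end SmoothTransition

section Convexity

variable {E : Type*} [NormedAddCommGroup E] [NormedSpace ℝ E]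

theorem apply_le_sub_of_convexOn {f : E → ℝ} {f' : E →L[ℝ] ℝ} {x : E} (hf : ConvexOn ℝ univ f)
    (h : HasFDerivAt f f' x) (v : E) : f' v ≤ f (x + v) - f x := by
  refine apply_le_of_hasFDerivAt_of_sub_le h ?_
  filter_upwards [Ioc_mem_nhdsGT (zero_lt_one' ℝ)] with s hs
  have hsv : x + s • v = (1 - s) • x + s • (x + v) := by module
  have hconv := hf.2 (mem_univ x) (mem_univ (x + v)) (sub_nonneg.2 hs.2) hs.1.le (by ring)
  rw [smul_eq_mul, smul_eq_mul] at hconv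
  rw [hsv]
  linarith

theorem IsStrictlyConvexNorm.midpoint_lt {N : Seminorm ℝ E} (hS : IsStrictlyConvexNorm N)
    {x y : E} (hx : 0 < N x) (hyx : N y ≤ N x) (hne : x ≠ y) :
    N ((1 / 2 : ℝ) • (x + y)) < N x := by
  rcases hyx.lt_or_eq with h | h
  · rw [map_smul_eq_mul, Real.norm_of_nonneg one_half_pos.le]
    linarith [map_add_le_add N x y]
  · have hunit : ∀ z, N z = N x → N ((N x)⁻¹ • z) = 1 := fun z hz => by
      rw [map_smul_eq_mul, hz, norm_inv, Real.norm_of_nonneg hx.le, inv_mul_cancel₀ hx.ne']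
    have hlt := hS _ _ (hunit x rfl) (hunit y h)
      fun h => hne (smul_right_injective E (inv_ne_zero hx.ne') h)
    rw [← smul_add, smul_comm, map_smul_eq_mul, norm_inv, Real.norm_of_nonneg hx.le,
      inv_mul_lt_iff₀ hx, mul_one] at hlt
    exact hlt

theorem IsStrictlyConvexNorm.sub_half_coord_lt {N : Seminorm ℝ E} {b : SchauderBasis ℝ E}
    (hS : IsStrictlyConvexNorm N) (hN : IsEquivalentNorm N)
    (hb : IsOneSuppressionUnconditional N b) {j : ℕ} {x : E} (hx : b.coord j x ≠ 0) :
    N (x - (b.coord j x / 2) • b j) < N x := by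
  have hx0 : x ≠ 0 := by rintro rfl; exact hx (map_zero _)
  have hne : x ≠ x - b.coord j x • b j := by
    intro h
    have hcoord := congrArg (b.coord j) h
    rw [map_sub, map_smul, coord_basis_self, smul_eq_mul, mul_one, sub_self] at hcoord
    exact hx hcoord
  have hmid : (1 / 2 : ℝ) • (x + (x - b.coord j x • b j)) = x - (b.coord j x / 2) • b j := by
    module
  exact hmid ▸ hS.midpoint_lt (hN.pos hx0) (hb x j) hne

end Convexity

section TailSize

variable {E : Type*} [NormedAddCommGroup E] [NormedSpace ℝ E] {N : Seminorm ℝ E}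
  {b : SchauderBasis ℝ E}

/-- A positive `C¹` substitute for the `N`-norm of the tail of `x` from index `k` on. -/
noncomputable def tailSize (N : Seminorm ℝ E) (b : SchauderBasis ℝ E) (k : ℕ) (x : E) : ℝ :=
  √(N (tailProj b k x) ^ 2 + ((1 / 2 : ℝ) ^ k) ^ 2)

theorem tailSize_sq (k : ℕ) (x : E) :
    tailSize N b k x ^ 2 = N (tailProj b k x) ^ 2 + ((1 / 2 : ℝ) ^ k) ^ 2 :=
  Real.sq_sqrt (by positivity)

theorem tailSize_pos (k : ℕ) (x : E) : 0 < tailSize N b k x :=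
  Real.sqrt_pos.2 (by positivity)

theorem half_pow_le_tailSize (k : ℕ) (x : E) : (1 / 2 : ℝ) ^ k ≤ tailSize N b k x :=
  Real.le_sqrt_of_sq_le (le_add_of_nonneg_left (by positivity))

theorem tailProj_le_tailSize (k : ℕ) (x : E) : N (tailProj b k x) ≤ tailSize N b k x :=
  Real.le_sqrt_of_sq_le (le_add_of_nonneg_right (by positivity))

theorem tailSize_le_of_tailProj_le {k : ℕ} {x y : E}
    (h : N (tailProj b k x) ≤ N (tailProj b k y)) : tailSize N b k x ≤ tailSize N b k y := by
  unfold tailSize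
  gcongr

theorem tailSize_add_le (k : ℕ) (x v : E) :
    tailSize N b k (x + v) ≤ tailSize N b k x + N (tailProj b k v) := by
  refine Real.sqrt_le_iff.2 ⟨add_nonneg (tailSize_pos k x).le (apply_nonneg N _), ?_⟩
  have hadd : N (tailProj b k (x + v)) ≤ N (tailProj b k x) + N (tailProj b k v) := by
    rw [map_add]; exact map_add_le_add N _ _
  have hsq := pow_le_pow_left₀ (apply_nonneg N _) hadd 2
  have hmul := mul_le_mul_of_nonneg_right (tailProj_le_tailSize (N := N) (b := b) k x)
    (apply_nonneg N (tailProj b k v))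
  linarith [tailSize_sq (N := N) (b := b) k x]

theorem convexOn_tailSize (k : ℕ) : ConvexOn ℝ univ (tailSize N b k) := by
  refine ⟨convex_univ, fun x _ y _ s t hs ht hst => ?_⟩
  have hx := tailSize_pos (N := N) (b := b) k x
  have hy := tailSize_pos (N := N) (b := b) k y
  have hN : N (tailProj b k (s • x + t • y))
      ≤ s * N (tailProj b k x) + t * N (tailProj b k y) := by
    simpa [Real.norm_of_nonneg hs, Real.norm_of_nonneg ht, map_smul_eq_mul] using
      map_add_le_add N (s • tailProj b k x) (t • tailProj b k y)
  have hcs : N (tailProj b k x) * N (tailProj b k y) + ((1 / 2 : ℝ) ^ k) ^ 2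
      ≤ tailSize N b k x * tailSize N b k y := by
    refine abs_le_of_sq_le_sq' ?_ (by positivity) |>.2
    rw [mul_pow, tailSize_sq, tailSize_sq]
    linarith [sq_nonneg ((1 / 2 : ℝ) ^ k * (N (tailProj b k x) - N (tailProj b k y)))]
  rw [smul_eq_mul, smul_eq_mul]
  refine Real.sqrt_le_iff.2 ⟨by positivity, ?_⟩
  calc _ ≤ (s * N (tailProj b k x) + t * N (tailProj b k y)) ^ 2
          + (s + t) ^ 2 * ((1 / 2 : ℝ) ^ k) ^ 2 := by rw [hst]; gcongr; simp
    _ = s ^ 2 * tailSize N b k x ^ 2 + t ^ 2 * tailSize N b k y ^ 2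
          + 2 * (s * t * (N (tailProj b k x) * N (tailProj b k y) + ((1 / 2 : ℝ) ^ k) ^ 2)) := by
        rw [tailSize_sq, tailSize_sq]; ring
    _ ≤ s ^ 2 * tailSize N b k x ^ 2 + t ^ 2 * tailSize N b k y ^ 2
          + 2 * (s * t * (tailSize N b k x * tailSize N b k y)) := by gcongr
    _ = (s * tailSize N b k x + t * tailSize N b k y) ^ 2 := by ring

theorem tailSize_anti (hb : IsOneSuppressionUnconditional N b) {k l : ℕ} (h : k ≤ l) (x : E) :
    tailSize N b l x ≤ tailSize N b k x := by
  have hpow : (1 / 2 : ℝ) ^ l ≤ (1 / 2) ^ k := pow_le_pow_of_le_one (by norm_num) (by norm_num) h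
  have htail := hb.tailProj_anti h x
  unfold tailSize
  gcongr

theorem tendsto_tailSize (hN : Continuous N) (x : E) :
    Tendsto (fun k => tailSize N b k x) atTop (𝓝 0) := by
  have htail : Tendsto (fun k => N (tailProj b k x)) atTop (𝓝 0) :=
    (hN.tendsto' 0 0 (map_zero N)).comp (tendsto_tailProj b x)
  have hpow : Tendsto (fun k : ℕ => (1 / 2 : ℝ) ^ k) atTop (𝓝 0) :=
    tendsto_pow_atTop_nhds_zero_of_lt_one (by norm_num) (by norm_num)
  simpa [tailSize] using ((htail.pow 2).add (hpow.pow 2)).sqrt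

section Derivative

variable (hN : IsEquivalentNorm N) (hC : IsC1Norm N)
include hN hC

theorem contDiff_tailSize (k : ℕ) : ContDiff ℝ 1 (tailSize N b k) :=
  (((hC.contDiff_sq hN).comp (tailProj b k).contDiff).add contDiff_const).sqrt fun x =>
    (Real.sqrt_pos.1 (tailSize_pos k x)).ne'

theorem hasFDerivAt_tailSize (k : ℕ) (x : E) :
    HasFDerivAt (tailSize N b k) (fderiv ℝ (tailSize N b k) x) x :=
  ((contDiff_tailSize hN hC k).differentiable one_ne_zero x).hasFDerivAt

theorem abs_fderiv_tailSize_le (k : ℕ) (x v : E) :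
    |fderiv ℝ (tailSize N b k) x v| ≤ N (tailProj b k v) := by
  simpa using abs_apply_le_of_hasFDerivAt_of_sub_le (L := 1)
    (N := N.comp (tailProj b k : E →ₗ[ℝ] E)) (hasFDerivAt_tailSize hN hC k x)
    (fun w => by simpa using sub_le_iff_le_add'.2 (tailSize_add_le k x w)) v

theorem fderiv_tailSize_basis_of_lt {j k : ℕ} (h : j < k) (x : E) :
    fderiv ℝ (tailSize N b k) x (b j) = 0 :=
  abs_nonpos_iff.1 <| (abs_fderiv_tailSize_le hN hC k x (b j)).trans_eq <| by
    rw [tailProj_basis_of_lt b h, map_zero]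

theorem coord_mul_fderiv_tailSize_nonneg (hb : IsOneSuppressionUnconditional N b) (j k : ℕ)
    (x : E) : 0 ≤ b.coord j x * fderiv ℝ (tailSize N b k) x (b j) := by
  rcases lt_or_ge j k with h | h
  · rw [fderiv_tailSize_basis_of_lt hN hC h, mul_zero]
  have hle : tailSize N b k (x + -(b.coord j x • b j)) ≤ tailSize N b k x := by
    refine tailSize_le_of_tailProj_le ?_
    have hcoord : b.coord j (tailProj b k x) = b.coord j x := by rw [coord_tailProj, if_pos h]
    rw [← sub_eq_add_neg, map_sub, map_smul, tailProj_basis_of_le b h, ← hcoord]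
    exact hb _ j
  have hderiv := apply_le_sub_of_convexOn (convexOn_tailSize (b := b) k)
    (hasFDerivAt_tailSize hN hC k x) (-(b.coord j x • b j))
  rw [map_neg, map_smul, smul_eq_mul] at hderiv
  linarith

theorem coord_eq_zero_of_fderiv_tailSize_eq_zero (hb : IsOneSuppressionUnconditional N b)
    (hS : IsStrictlyConvexNorm N) {j k : ℕ} (h : k ≤ j) {x : E}
    (h0 : fderiv ℝ (tailSize N b k) x (b j) = 0) : b.coord j x = 0 := by
  by_contra hx
  have hcoord : b.coord j (tailProj b k x) = b.coord j x := by rw [coord_tailProj, if_pos h]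
  have hlt : tailSize N b k (x + -((b.coord j x / 2) • b j)) < tailSize N b k x := by
    refine Real.sqrt_lt_sqrt (by positivity) ?_
    gcongr
    rw [← sub_eq_add_neg, map_sub, map_smul, tailProj_basis_of_le b h, ← hcoord]
    exact hS.sub_half_coord_lt hN hb (hcoord ▸ hx)
  have hderiv := apply_le_sub_of_convexOn (convexOn_tailSize (b := b) k)
    (hasFDerivAt_tailSize hN hC k x) (-((b.coord j x / 2) • b j))
  rw [map_neg, map_smul, h0, smul_zero, neg_zero] at hderiv
  linarith

end Derivative

end TailSize

section Freezing

variable {E : Type*} [NormedAddCommGroup E] [NormedSpace ℝ E] {N : Seminorm ℝ E}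
  {b : SchauderBasis ℝ E} {L : ℝ} {τ : ℕ → E → ℝ}

/-- An increasing sequence of nonnegative `C¹` functions that are `L`-Lipschitz for `N`; `τ k y` is
the tolerance at `y` for neglecting the coordinates from index `k` on. -/
structure IsRadiusFamily (N : Seminorm ℝ E) (L : ℝ) (τ : ℕ → E → ℝ) : Prop where
  contDiff : ∀ k, ContDiff ℝ 1 (τ k)
  nonneg : ∀ k y, 0 ≤ τ k y
  mono : ∀ y, Monotone fun k => τ k y
  add_le : ∀ k y w, τ k (y + w) ≤ τ k y + L * N w

/-- The partial sums of the expansion of `x`, frozen smoothly once the size of the tail is small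
compared with the radius at the current partial sum. -/
noncomputable def frozenSum (N : Seminorm ℝ E) (b : SchauderBasis ℝ E) (τ : ℕ → E → ℝ) :
    ℕ → E → E
  | 0, _ => 0
  | k + 1, x => frozenSum N b τ k x +
      (Real.smoothTransition (2 - τ k (frozenSum N b τ k x) / tailSize N b k x) * b.coord k x) • b k

/-- The radius at the `k`-th frozen sum of `x`, relative to the size of the `k`-th tail of `x`. -/
noncomputable def radiusRatio (N : Seminorm ℝ E) (b : SchauderBasis ℝ E) (τ : ℕ → E → ℝ)
    (k : ℕ) (x : E) : ℝ :=
  τ k (frozenSum N b τ k x) / tailSize N b k x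

theorem frozenSum_succ (k : ℕ) (x : E) : frozenSum N b τ (k + 1) x = frozenSum N b τ k x +
    (Real.smoothTransition (2 - radiusRatio N b τ k x) * b.coord k x) • b k := rfl

theorem radiusRatio_mul_tailSize (k : ℕ) (x : E) :
    radiusRatio N b τ k x * tailSize N b k x = τ k (frozenSum N b τ k x) :=
  div_mul_cancel₀ _ (tailSize_pos k x).ne'

theorem frozenSum_eq_sum (k : ℕ) (x : E) : frozenSum N b τ k x = ∑ l ∈ Finset.range k,
    (Real.smoothTransition (2 - radiusRatio N b τ l x) * b.coord l x) • b l := by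
  induction k with
  | zero => rfl
  | succ k ih => rw [frozenSum_succ, Finset.sum_range_succ, ih]

theorem frozenSum_eq_proj {k : ℕ} {x : E} (h : ∀ l < k, radiusRatio N b τ l x ≤ 1) :
    frozenSum N b τ k x = b.proj k x := by
  rw [frozenSum_eq_sum, SchauderBasis.proj_apply]
  refine Finset.sum_congr rfl fun l hl => ?_
  rw [Real.smoothTransition.one_of_one_le (by linarith [h l (Finset.mem_range.1 hl)]), one_mul]

theorem frozenSum_succ_of_two_le {k : ℕ} {x : E} (h : 2 ≤ radiusRatio N b τ k x) :
    frozenSum N b τ (k + 1) x = frozenSum N b τ k x := by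
  rw [frozenSum_succ, Real.smoothTransition.zero_of_nonpos (by linarith), zero_mul, zero_smul,
    add_zero]

namespace IsRadiusFamily

variable (hτ : IsRadiusFamily N L τ)
include hτ

theorem hasFDerivAt (k : ℕ) (y : E) : HasFDerivAt (τ k) (fderiv ℝ (τ k) y) y :=
  ((hτ.contDiff k).differentiable one_ne_zero y).hasFDerivAt

theorem abs_fderiv_le (k : ℕ) (y v : E) : |fderiv ℝ (τ k) y v| ≤ L * N v :=
  abs_apply_le_of_hasFDerivAt_of_sub_le (hτ.hasFDerivAt k y)
    (fun w => sub_le_iff_le_add'.2 (hτ.add_le k y w)) v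

theorem radiusRatio_nonneg (k : ℕ) (x : E) : 0 ≤ radiusRatio N b τ k x :=
  div_nonneg (hτ.nonneg _ _) (tailSize_pos _ _).le

theorem radiusRatio_le_succ (hb : IsOneSuppressionUnconditional N b) {k : ℕ} {x : E}
    (h : 2 ≤ radiusRatio N b τ k x) : radiusRatio N b τ k x ≤ radiusRatio N b τ (k + 1) x := by
  rw [radiusRatio, radiusRatio, frozenSum_succ_of_two_le h]
  exact div_le_div₀ (hτ.nonneg _ _) (hτ.mono _ k.le_succ) (tailSize_pos _ _)
    (tailSize_anti hb k.le_succ x)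

theorem radiusRatio_mono (hb : IsOneSuppressionUnconditional N b) {k l : ℕ} (hkl : k ≤ l) {x : E}
    (h : 2 ≤ radiusRatio N b τ k x) : radiusRatio N b τ k x ≤ radiusRatio N b τ l x := by
  induction l, hkl using Nat.le_induction with
  | base => exact le_rfl
  | succ l _ ih => exact ih.trans (hτ.radiusRatio_le_succ hb (h.trans ih))

theorem frozenSum_eq (hb : IsOneSuppressionUnconditional N b) {k l : ℕ} (hkl : k ≤ l) {x : E}
    (h : 2 ≤ radiusRatio N b τ k x) : frozenSum N b τ l x = frozenSum N b τ k x := by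
  induction l, hkl using Nat.le_induction with
  | base => rfl
  | succ l hl ih => rw [frozenSum_succ_of_two_le (h.trans (hτ.radiusRatio_mono hb hl h)), ih]

variable (hN : IsEquivalentNorm N) (hC : IsC1Norm N)
include hN hC

theorem contDiff_frozenSum (k : ℕ) : ContDiff ℝ 1 (frozenSum N b τ k) := by
  induction k with
  | zero => exact contDiff_const
  | succ k ih =>
    have hratio : ContDiff ℝ 1 fun x => τ k (frozenSum N b τ k x) / tailSize N b k x :=
      ((hτ.contDiff k).comp ih).div (contDiff_tailSize hN hC k) fun x => (tailSize_pos k x).ne'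
    exact ih.add (((Real.smoothTransition.contDiff.comp (contDiff_const.sub hratio)).mul
      (b.coord k).contDiff).smul contDiff_const)

theorem contDiff_radiusRatio (k : ℕ) : ContDiff ℝ 1 (radiusRatio N b τ k) :=
  ((hτ.contDiff k).comp (hτ.contDiff_frozenSum hN hC k)).div (contDiff_tailSize hN hC k) fun x =>
    (tailSize_pos k x).ne'

theorem hasFDerivAt_frozenSum (k : ℕ) (x : E) :
    HasFDerivAt (frozenSum N b τ k) (fderiv ℝ (frozenSum N b τ k) x) x :=
  ((hτ.contDiff_frozenSum hN hC k).differentiable one_ne_zero x).hasFDerivAt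

theorem hasFDerivAt_radiusRatio (k : ℕ) (x : E) :
    HasFDerivAt (radiusRatio N b τ k) (fderiv ℝ (radiusRatio N b τ k) x) x :=
  ((hτ.contDiff_radiusRatio hN hC k).differentiable one_ne_zero x).hasFDerivAt

theorem fderiv_radiusRatio_apply (k : ℕ) (x v : E) :
    fderiv ℝ (radiusRatio N b τ k) x v =
      (fderiv ℝ (τ k) (frozenSum N b τ k x) (fderiv ℝ (frozenSum N b τ k) x v)
        - radiusRatio N b τ k x * fderiv ℝ (tailSize N b k) x v) / tailSize N b k x := by
  have hcomp : HasFDerivAt (fun x => τ k (frozenSum N b τ k x)) _ x :=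
    (hτ.hasFDerivAt k _).comp x (hτ.hasFDerivAt_frozenSum (b := b) hN hC k x)
  have hmul : HasFDerivAt (fun x => radiusRatio N b τ k x * tailSize N b k x) _ x :=
    (hτ.hasFDerivAt_radiusRatio hN hC k x).mul (hasFDerivAt_tailSize (b := b) hN hC k x)
  simp only [radiusRatio_mul_tailSize] at hmul
  have hv := DFunLike.congr_fun (hcomp.unique hmul) v
  simp only [ContinuousLinearMap.comp_apply, add_apply, smul_apply, smul_eq_mul] at hv
  rw [eq_div_iff (tailSize_pos k x).ne', hv]
  ring

theorem fderiv_frozenSum_succ_apply (k : ℕ) (x v : E) :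
    fderiv ℝ (frozenSum N b τ (k + 1)) x v = fderiv ℝ (frozenSum N b τ k) x v +
      (Real.smoothTransition (2 - radiusRatio N b τ k x) * b.coord k v -
        deriv Real.smoothTransition (2 - radiusRatio N b τ k x) *
          fderiv ℝ (radiusRatio N b τ k) x v * b.coord k x) • b k := by
  have hfactor := (hasDerivAt_smoothTransition (2 - radiusRatio N b τ k x)).comp_hasFDerivAt x
    ((hτ.hasFDerivAt_radiusRatio (b := b) hN hC k x).const_sub 2)
  have hsum : HasFDerivAt (frozenSum N b τ (k + 1)) _ x :=
    (hτ.hasFDerivAt_frozenSum (b := b) hN hC k x).add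
      ((hfactor.mul (b.coord k).hasFDerivAt).smul_const (b k))
  rw [hsum.fderiv]
  simp only [Function.comp_apply, add_apply, smul_apply, smul_eq_mul, neg_apply,
    ContinuousLinearMap.smulRight_apply]
  congr 2
  ring

theorem fderiv_frozenSum_apply (k : ℕ) (x v : E) :
    fderiv ℝ (frozenSum N b τ k) x v =
      ∑ l ∈ Finset.range k,
        (Real.smoothTransition (2 - radiusRatio N b τ l x) * b.coord l v) • b l +
      ∑ l ∈ Finset.range k, (-(deriv Real.smoothTransition (2 - radiusRatio N b τ l x) *
          fderiv ℝ (radiusRatio N b τ l) x v) * b.coord l x) • b l := by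
  induction k with
  | zero =>
    have hzero : HasFDerivAt (frozenSum N b τ 0) (0 : E →L[ℝ] E) x := hasFDerivAt_const _ _
    simp [hzero.fderiv]
  | succ k ih =>
    rw [hτ.fderiv_frozenSum_succ_apply hN hC, ih, Finset.sum_range_succ, Finset.sum_range_succ]
    module

theorem coord_fderiv_frozenSum {j k : ℕ} (h : k ≤ j) (x v : E) :
    b.coord j (fderiv ℝ (frozenSum N b τ k) x v) = 0 := by
  rw [hτ.fderiv_frozenSum_apply hN hC, map_add, coord_sum_smul, coord_sum_smul,
    if_neg (by simpa using h), if_neg (by simpa using h), add_zero]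

theorem tailProj_fderiv_frozenSum (k : ℕ) (x v : E) :
    tailProj b k (fderiv ℝ (frozenSum N b τ k) x v) = 0 := by
  rw [hτ.fderiv_frozenSum_apply hN hC, map_add, map_sum, map_sum, Finset.sum_eq_zero,
    Finset.sum_eq_zero, add_zero]
  all_goals
    intro l hl
    rw [map_smul, tailProj_basis_of_lt b (Finset.mem_range.1 hl), smul_zero]

theorem fderiv_frozenSum_eq (hb : IsOneSuppressionUnconditional N b) {k l : ℕ} (hkl : k ≤ l)
    {x : E} (h : 2 ≤ radiusRatio N b τ k x) :
    fderiv ℝ (frozenSum N b τ l) x = fderiv ℝ (frozenSum N b τ k) x := by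
  induction l, hkl using Nat.le_induction with
  | base => rfl
  | succ l hl ih =>
    have hl2 := h.trans (hτ.radiusRatio_mono hb hl h)
    ext v
    rw [hτ.fderiv_frozenSum_succ_apply hN hC, ih,
      Real.smoothTransition.zero_of_nonpos (by linarith),
      deriv_smoothTransition_of_nonpos (by linarith)]
    simp only [zero_mul, sub_zero, zero_smul, add_zero]

/-- Passing from `frozenSum m` to `frozenSum (m + 1)` does not lose the direction of `b m`: the
derivative of the freezing factor contributes with the same sign as the factor itself. -/
theorem coord_eq_zero_of_fderiv_frozenSum_succ_eq_zero (hb : IsOneSuppressionUnconditional N b)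
    {m : ℕ} {x v : E} (h : radiusRatio N b τ m x < 2)
    (hv : tailProj b m v = b.coord m v • b m)
    (h0 : fderiv ℝ (frozenSum N b τ m) x v = 0)
    (h1 : fderiv ℝ (frozenSum N b τ (m + 1)) x v = 0) : b.coord m v = 0 := by
  set ρ := radiusRatio N b τ m x
  have htail : fderiv ℝ (tailSize N b m) x v = b.coord m v * fderiv ℝ (tailSize N b m) x (b m) := by
    have hle := abs_fderiv_tailSize_le (b := b) hN hC m x (v - b.coord m v • b m)
    rw [map_sub (tailProj b m), hv, map_smul (tailProj b m), tailProj_basis_of_le b le_rfl,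
      sub_self, map_zero] at hle
    simpa [sub_eq_zero] using abs_nonpos_iff.1 hle
  have hcoord := congrArg (b.coord m) h1
  rw [hτ.fderiv_frozenSum_succ_apply hN hC, h0, zero_add, map_smul, coord_basis_self, map_zero,
    smul_eq_mul, mul_one, hτ.fderiv_radiusRatio_apply hN hC, h0, map_zero, htail] at hcoord
  have hfactor : 0 < Real.smoothTransition (2 - ρ) :=
    Real.smoothTransition.pos_of_pos (by linarith)
  have hslope : 0 ≤ deriv Real.smoothTransition (2 - ρ) * (ρ / tailSize N b m x) *
      (b.coord m x * fderiv ℝ (tailSize N b m) x (b m)) :=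
    mul_nonneg (mul_nonneg Real.smoothTransition.monotone.deriv_nonneg
      (div_nonneg (hτ.radiusRatio_nonneg _ _) (tailSize_pos _ _).le))
      (coord_mul_fderiv_tailSize_nonneg hN hC hb m m x)
  refine (mul_eq_zero.1 (?_ : b.coord m v * (Real.smoothTransition (2 - ρ) +
    deriv Real.smoothTransition (2 - ρ) * (ρ / tailSize N b m x) *
      (b.coord m x * fderiv ℝ (tailSize N b m) x (b m))) = 0)).resolve_right (by positivity)
  rw [← hcoord]
  ring

theorem eq_zero_of_fderiv_frozenSum_eq_zero (hb : IsOneSuppressionUnconditional N b) {m : ℕ}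
    {x : E} (h : ∀ l < m, radiusRatio N b τ l x < 2) {v : E} (hv : tailProj b m v = 0)
    (h0 : fderiv ℝ (frozenSum N b τ m) x v = 0) : v = 0 := by
  induction m generalizing v with
  | zero => simpa [tailProj_apply, SchauderBasis.proj_apply] using hv
  | succ m ih =>
    have htail : tailProj b m v = b.coord m v • b m := by
      rwa [tailProj_succ, sub_eq_zero] at hv
    have h0m : fderiv ℝ (frozenSum N b τ m) x v = 0 := by
      have hsucc := hτ.fderiv_frozenSum_succ_apply (b := b) hN hC m x v
      rw [h0] at hsucc
      have hcoord := congrArg (b.coord m) hsucc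
      rw [map_add, hτ.coord_fderiv_frozenSum hN hC le_rfl, zero_add, map_smul, coord_basis_self,
        map_zero, smul_eq_mul, mul_one] at hcoord
      rwa [← hcoord, zero_smul, add_zero, eq_comm] at hsucc
    have hvm := hτ.coord_eq_zero_of_fderiv_frozenSum_succ_eq_zero hN hC hb (h m m.lt_succ_self)
      htail h0m h0
    exact ih (fun l hl => h l (hl.trans m.lt_succ_self)) (by rw [htail, hvm, zero_smul]) h0m

/-- Before freezing, the derivative is injective on the span of the first `m` basis vectors, hence
bijective there. -/
theorem exists_mem_range_proj_fderiv_frozenSum_eq (hb : IsOneSuppressionUnconditional N b) {m : ℕ}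
    {x : E} (h : ∀ l < m, radiusRatio N b τ l x < 2) (v : E) :
    ∃ w ∈ (b.proj m).range,
      fderiv ℝ (frozenSum N b τ m) x w = fderiv ℝ (frozenSum N b τ m) x v := by
  set D := fderiv ℝ (frozenSum N b τ m) x
  have hmem : ∀ w, D w ∈ (b.proj m).range := fun w =>
    (mem_range_proj_iff b).2 (hτ.tailProj_fderiv_frozenSum hN hC m x w)
  have hfin : FiniteDimensional ℝ (b.proj m).range := by
    rw [SchauderBasis.range_proj_eq_span]
    exact FiniteDimensional.span_of_finite ℝ ((Finset.finite_toSet _).image _)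
  let D' : (b.proj m).range →ₗ[ℝ] (b.proj m).range := (D : E →ₗ[ℝ] E).restrict fun w _ => hmem w
  have hinj : Function.Injective D' := (injective_iff_map_eq_zero D').2 fun w hw =>
    Subtype.ext <| hτ.eq_zero_of_fderiv_frozenSum_eq_zero hN hC hb h
      ((mem_range_proj_iff b).1 w.2) (congrArg Subtype.val hw)
  obtain ⟨w, hw⟩ := LinearMap.injective_iff_surjective.1 hinj ⟨D v, hmem v⟩
  exact ⟨w, w.2, congrArg Subtype.val hw⟩

theorem comp_fderiv_frozenSum_eq_zero (hb : IsOneSuppressionUnconditional N b) {m : ℕ} {x : E}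
    (h : ∀ l < m, radiusRatio N b τ l x < 2) {φ : E →L[ℝ] ℝ}
    (hφ : ∀ j < m, φ (fderiv ℝ (frozenSum N b τ m) x (b j)) = 0) (v : E) :
    φ (fderiv ℝ (frozenSum N b τ m) x v) = 0 := by
  obtain ⟨w, hw, hwv⟩ := hτ.exists_mem_range_proj_fderiv_frozenSum_eq hN hC hb h v
  have hle : (b.proj m).range ≤ (φ.comp (fderiv ℝ (frozenSum N b τ m) x)).ker := by
    rw [SchauderBasis.range_proj_eq_span, Submodule.span_le]
    rintro _ ⟨i, hi, rfl⟩
    exact hφ i (Finset.mem_range.1 hi)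
  rw [← hwv]
  exact hle hw

end IsRadiusFamily

end Freezing

section FirstDominated

variable {E : Type*} [NormedAddCommGroup E] [NormedSpace ℝ E] {N : Seminorm ℝ E}
  {b : SchauderBasis ℝ E} {L : ℝ} {τ : ℕ → E → ℝ}

/-- `m` is the first index at which the radius dominates the size of the tail; up to this index the
frozen sums of `x` are its partial sums. -/
def IsFirstDominated (N : Seminorm ℝ E) (b : SchauderBasis ℝ E) (τ : ℕ → E → ℝ) (m : ℕ)
    (x : E) : Prop :=
  (∀ l < m, radiusRatio N b τ l x < 1) ∧ 1 ≤ radiusRatio N b τ m x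

theorem exists_isFirstDominated (hN : Continuous N) {x : E} {s : ℝ} (hs : 0 < s) {k₀ : ℕ}
    (h : ∀ᶠ y in 𝓝 x, ∀ k ≥ k₀, s ≤ τ k y) : ∃ m, IsFirstDominated N b τ m x := by
  classical
  have hex : ∃ m, 1 ≤ radiusRatio N b τ m x := by
    by_contra! hlt
    have hproj := (SchauderBasis.tendsto_proj b x).eventually h
    have hsmall := (tendsto_tailSize (b := b) hN x).eventually_lt_const hs
    obtain ⟨k, hτk, hk, hk₀⟩ := (hproj.and (hsmall.and (eventually_ge_atTop k₀))).exists
    have hratio := hlt k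
    rw [radiusRatio, frozenSum_eq_proj fun l _ => (hlt l).le, div_lt_one (tailSize_pos k x)]
      at hratio
    linarith [hτk k hk₀]
  exact ⟨Nat.find hex, fun l hl => not_le.1 (Nat.find_min hex hl), Nat.find_spec hex⟩

namespace IsFirstDominated

variable {m : ℕ} {x : E} (h : IsFirstDominated N b τ m x)
include h

theorem frozenSum_eq : frozenSum N b τ m x = b.proj m x :=
  frozenSum_eq_proj fun l hl => (h.1 l hl).le

theorem le_of_one_le_radiusRatio {j : ℕ} (hj : 1 ≤ radiusRatio N b τ j x) : m ≤ j :=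
  not_lt.1 fun hlt => (h.1 j hlt).not_ge hj

theorem tailSize_le : tailSize N b m x ≤ τ m (b.proj m x) := by
  rw [← h.frozenSum_eq, ← radiusRatio_mul_tailSize (N := N) (b := b) (τ := τ)]
  exact le_mul_of_one_le_left (tailSize_pos m x).le h.2

theorem tailProj_le : N (tailProj b m x) ≤ τ m (b.proj m x) :=
  (tailProj_le_tailSize m x).trans h.tailSize_le

theorem frozenSum_sub_le (hb : IsOneSuppressionUnconditional N b) (hN : Continuous N) {j : ℕ}
    (hj : m ≤ j) : N (frozenSum N b τ j x - b.proj m x) ≤ N (tailProj b m x) := by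
  have hsum : frozenSum N b τ j x - b.proj m x = ∑ l ∈ Finset.Ico m j,
      (Real.smoothTransition (2 - radiusRatio N b τ l x) * b.coord l x) • b l := by
    rw [← h.frozenSum_eq, frozenSum_eq_sum, frozenSum_eq_sum, Finset.sum_Ico_eq_sub _ hj]
  rw [hsum]
  exact hb.sum_le_tailProj hN _ (fun l hl hlt => absurd hlt (Finset.mem_Ico.1 hl).1.not_gt)
    (fun l _ => Real.smoothTransition.nonneg _) (fun l _ => Real.smoothTransition.le_one _) x

section Radius

variable (hτ : IsRadiusFamily N L τ) (hb : IsOneSuppressionUnconditional N b) (hN : Continuous N)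
  (hL : L ≤ 1 / 2)
include hτ hb hN hL

theorem radius_le {j : ℕ} (hj : m ≤ j) :
    τ m (b.proj m x) ≤ 2 * (radiusRatio N b τ j x * tailSize N b j x) := by
  rw [radiusRatio_mul_tailSize]
  have hmono : τ m (frozenSum N b τ j x) ≤ τ j (frozenSum N b τ j x) := hτ.mono _ hj
  have hlip := hτ.add_le m (frozenSum N b τ j x) (b.proj m x - frozenSum N b τ j x)
  rw [add_sub_cancel, map_sub_rev] at hlip
  have hclose : L * N (frozenSum N b τ j x - b.proj m x) ≤ 1 / 2 * τ m (b.proj m x) :=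
    mul_le_mul hL ((h.frozenSum_sub_le hb hN hj).trans h.tailProj_le) (apply_nonneg N _)
      one_half_pos.le
  linarith

theorem tailSize_le_mul {j : ℕ} (hj : m ≤ j) {R : ℝ} (hR : radiusRatio N b τ j x ≤ R) :
    tailSize N b m x ≤ 2 * R * tailSize N b j x :=
  calc tailSize N b m x ≤ 2 * (radiusRatio N b τ j x * tailSize N b j x) :=
        h.tailSize_le.trans (h.radius_le hτ hb hN hL hj)
    _ ≤ 2 * (R * tailSize N b j x) := by gcongr; exact (tailSize_pos j x).le
    _ = 2 * R * tailSize N b j x := (mul_assoc _ _ _).symm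

theorem exists_lt_radiusRatio (R : ℝ) : ∃ k, R < radiusRatio N b τ k x := by
  by_contra! hR
  have hlim : Tendsto (fun j => 2 * R * tailSize N b j x) atTop (𝓝 0) := by
    simpa using (tendsto_tailSize (b := b) hN x).const_mul (2 * R)
  have hle : ∀ᶠ j in atTop, tailSize N b m x ≤ 2 * R * tailSize N b j x :=
    eventually_atTop.2 ⟨m, fun j hj => h.tailSize_le_mul hτ hb hN hL hj (hR j)⟩
  exact (tailSize_pos m x).not_ge (ge_of_tendsto hlim hle)

end Radius

variable (hτ : IsRadiusFamily N L τ) (hN : IsEquivalentNorm N) (hC : IsC1Norm N)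
include hτ hN hC

theorem fderiv_frozenSum_eq (v : E) : fderiv ℝ (frozenSum N b τ m) x v = b.proj m v := by
  have hratio : ∀ l ∈ Finset.range m, 1 ≤ 2 - radiusRatio N b τ l x := fun l hl => by
    linarith [h.1 l (Finset.mem_range.1 hl)]
  have hsum : ∑ l ∈ Finset.range m, (-(deriv Real.smoothTransition (2 - radiusRatio N b τ l x) *
      fderiv ℝ (radiusRatio N b τ l) x v) * b.coord l x) • b l = 0 :=
    Finset.sum_eq_zero fun l hl => by
      rw [deriv_smoothTransition_of_one_le (hratio l hl), zero_mul, neg_zero, zero_mul, zero_smul]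
  rw [hτ.fderiv_frozenSum_apply hN hC, SchauderBasis.proj_apply, hsum, add_zero]
  exact Finset.sum_congr rfl fun l hl => by
    rw [Real.smoothTransition.one_of_one_le (hratio l hl), one_mul]

theorem tailProj_fderiv_frozenSum_sub {j : ℕ} (hj : m ≤ j) (v : E) :
    tailProj b m (fderiv ℝ (frozenSum N b τ j) x v - v)
      = fderiv ℝ (frozenSum N b τ j) x v - v := by
  induction j, hj using Nat.le_induction with
  | base =>
    rw [h.fderiv_frozenSum_eq hτ hN hC, ← neg_sub, ← tailProj_apply, map_neg,
      tailProj_tailProj b le_rfl]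
  | succ j hj ih =>
    rw [hτ.fderiv_frozenSum_succ_apply hN hC, add_sub_right_comm, map_add, ih, map_smul,
      tailProj_basis_of_le b hj]

variable (hb : IsOneSuppressionUnconditional N b)
include hb

theorem abs_fderiv_radiusRatio_le (hL0 : 0 ≤ L) (hL : L ≤ 1 / 2) {j : ℕ} (hj : m ≤ j) {R M : ℝ}
    (hR : radiusRatio N b τ j x ≤ R) {v : E}
    (hM : N (fderiv ℝ (frozenSum N b τ j) x v) ≤ M * N v) :
    |fderiv ℝ (radiusRatio N b τ j) x v| ≤ 2 * R * (L * M + R) * N v / tailSize N b m x := by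
  have hR0 : 0 ≤ R := (hτ.radiusRatio_nonneg j x).trans hR
  have hnum : |fderiv ℝ (τ j) (frozenSum N b τ j x) (fderiv ℝ (frozenSum N b τ j) x v)
      - radiusRatio N b τ j x * fderiv ℝ (tailSize N b j) x v| ≤ (L * M + R) * N v :=
    calc _ ≤ |fderiv ℝ (τ j) (frozenSum N b τ j x) (fderiv ℝ (frozenSum N b τ j) x v)|
          + |radiusRatio N b τ j x| * |fderiv ℝ (tailSize N b j) x v| := by
          rw [← abs_mul]; exact abs_sub _ _
      _ ≤ L * (M * N v) + R * N v := by
          rw [abs_of_nonneg (hτ.radiusRatio_nonneg j x)]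
          gcongr
          · exact (hτ.abs_fderiv_le _ _ _).trans (by gcongr)
          · exact (abs_fderiv_tailSize_le hN hC j x v).trans (hb.tailProj_le j v)
      _ = (L * M + R) * N v := by ring
  rw [hτ.fderiv_radiusRatio_apply hN hC, abs_div, abs_of_pos (tailSize_pos j x),
    div_le_div_iff₀ (tailSize_pos j x) (tailSize_pos m x)]
  calc _ ≤ (L * M + R) * N v * (2 * R * tailSize N b j x) :=
        mul_le_mul hnum (h.tailSize_le_mul hτ hb hN.continuous hL hj hR) (tailSize_pos m x).le
          ((abs_nonneg _).trans hnum)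
    _ = 2 * R * (L * M + R) * N v * tailSize N b j x := by ring

theorem fderiv_frozenSum_le {c : ℝ} (hc1 : 1 ≤ c)
    (hc : ∀ s, |deriv Real.smoothTransition s| ≤ c) (hL0 : 0 ≤ L) (hL : 16 * c * L ≤ 1)
    (j : ℕ) (v : E) : N (fderiv ℝ (frozenSum N b τ j) x v) ≤ 34 * c * N v := by
  have hL2 : L ≤ 1 / 2 := by linarith [mul_le_mul_of_nonneg_right hc1 hL0]
  have hc0 : 0 ≤ c := zero_le_one.trans hc1
  induction j using Nat.strong_induction_on with
  | _ j ih =>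
  set a : ℕ → ℝ := fun l =>
    -(deriv Real.smoothTransition (2 - radiusRatio N b τ l x) * fderiv ℝ (radiusRatio N b τ l) x v)
  set M := c * (2 * 2 * (L * (34 * c) + 2) * N v / tailSize N b m x) with hM
  have ht := tailSize_pos (N := N) (b := b) m x
  have hM0 : 0 ≤ M := by positivity
  have ha0 : ∀ l ∈ Finset.range j, l < m → a l = 0 := fun l _ hl => by
    simp only [a, deriv_smoothTransition_of_one_le (by linarith [h.1 l hl] :
      1 ≤ 2 - radiusRatio N b τ l x), zero_mul, neg_zero]
  have haM : ∀ l ∈ Finset.range j, |a l| ≤ M := by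
    intro l hl
    rcases lt_or_ge l m with hlm | hml
    · rwa [ha0 l hl hlm, abs_zero]
    rw [abs_neg, abs_mul]
    rcases le_or_gt 2 (radiusRatio N b τ l x) with h2 | h2
    · rwa [deriv_smoothTransition_of_nonpos (by linarith), abs_zero, zero_mul]
    · exact mul_le_mul (hc _) (h.abs_fderiv_radiusRatio_le hτ hN hC hb hL0 hL2 hml h2.le
        (ih l (Finset.mem_range.1 hl))) (abs_nonneg _) hc0
  have hmain := hb.sum_le_tailProj hN.continuous (Finset.range j) (k := 0)
    (a := fun l => Real.smoothTransition (2 - radiusRatio N b τ l x)) (by simp)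
    (fun l _ => Real.smoothTransition.nonneg _) (fun l _ => Real.smoothTransition.le_one _) v
  rw [hτ.fderiv_frozenSum_apply hN hC]
  calc _ ≤ N v + 2 * M * tailSize N b m x :=
        (map_add_le_add N _ _).trans <| add_le_add (hmain.trans (hb.tailProj_le 0 v)) <|
          (hb.sum_le_of_abs_le hN.continuous _ ha0 haM hM0 x).trans <| by
            gcongr; exact tailProj_le_tailSize m x
    _ = (1 + 17 * c * (16 * c * L) + 16 * c) * N v := by rw [hM]; field_simp; ring
    _ ≤ (c + 17 * c * 1 + 16 * c) * N v := by gcongr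
    _ = 34 * c * N v := by ring

end IsFirstDominated

end FirstDominated

section WeightedMap

variable {E F : Type*} [NormedAddCommGroup E] [NormedSpace ℝ E] [NormedAddCommGroup F]
  [NormedSpace ℝ F] {N : Seminorm ℝ E} {b : SchauderBasis ℝ E} {w : ℕ → F}

/-- Rapidly decreasing weights for the coordinates of the basis `b`, normalised by `N`. -/
noncomputable def coordWeight (N : Seminorm ℝ E) (b : SchauderBasis ℝ E) (j : ℕ) : ℝ :=
  (1 / 8) ^ j * N (b j)

/-- The operator `x ↦ ∑ λ_j x_j w_j` with the weights `λ_j = coordWeight N b j`. -/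
noncomputable def weightedMap (N : Seminorm ℝ E) (b : SchauderBasis ℝ E) (w : ℕ → F) : E →L[ℝ] F :=
  ∑' j, (coordWeight N b j • b.coord j).smulRight (w j)

theorem coordWeight_pos (hN : IsEquivalentNorm N) (j : ℕ) : 0 < coordWeight N b j := by
  have hbj : b j ≠ 0 := fun h => one_ne_zero (α := ℝ) <| by
    rw [← coord_basis_self b j, h, map_zero]
  exact mul_pos (by positivity) (hN.pos hbj)

theorem norm_sum_smul_le (hw : ∀ j, ‖w j‖ ≤ 1) {a : ℕ → ℝ} {B : ℝ} (hB : 0 ≤ B)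
    (ha : ∀ j, |a j| ≤ B * (1 / 2) ^ j) {K : ℕ} :
    ‖∑ j ∈ Finset.range K, a j • w j‖ ≤ B * 2 :=
  calc ‖∑ j ∈ Finset.range K, a j • w j‖ ≤ ∑ j ∈ Finset.range K, B * (1 / 2) ^ j := by
        refine norm_sum_le_of_le _ fun j _ => ?_
        rw [norm_smul]
        exact (mul_le_of_le_one_right (norm_nonneg _) (hw j)).trans (ha j)
    _ ≤ B * 2 := sum_le_hasSum _ (fun _ _ => by positivity) (hasSum_geometric_two.mul_left B)

section Bounds

variable (hb : IsOneSuppressionUnconditional N b)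
include hb

theorem abs_coordWeight_mul_le (hN : Continuous N) {j k : ℕ} (h : k ≤ j) (x : E) :
    |coordWeight N b j * b.coord j x| ≤ (1 / 2) ^ k * (1 / 4) ^ j * N (tailProj b k x) := by
  have hpow : (1 / 8 : ℝ) ^ j ≤ (1 / 2) ^ k * (1 / 4) ^ j :=
    calc (1 / 8 : ℝ) ^ j = (1 / 2) ^ j * (1 / 4) ^ j := by rw [← mul_pow]; norm_num
      _ ≤ (1 / 2) ^ k * (1 / 4) ^ j := by
        gcongr ?_ * _
        exact pow_le_pow_of_le_one (by norm_num) (by norm_num) h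
  rw [coordWeight, abs_mul, abs_of_nonneg (by positivity), mul_assoc, mul_comm (N _)]
  gcongr
  exact hb.abs_coord_mul_le hN h x

variable [CompleteSpace F] (hN : IsEquivalentNorm N) (hw : ∀ j, ‖w j‖ ≤ 1)
include hN hw

theorem summable_coordWeight_smul_smulRight :
    Summable fun j => (coordWeight N b j • b.coord j).smulRight (w j) := by
  have hcont := hN.continuous
  obtain ⟨_, C, _, hC, h⟩ := hN
  refine Summable.of_norm_bounded (g := fun j => C * (1 / 4 : ℝ) ^ j)
    ((summable_geometric_of_lt_one (by norm_num) (by norm_num)).mul_left _) fun j => ?_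
  refine ContinuousLinearMap.opNorm_le_bound _ (by positivity) fun v => ?_
  rw [ContinuousLinearMap.smulRight_apply, norm_smul, smul_apply, smul_eq_mul, Real.norm_eq_abs]
  calc |coordWeight N b j * b.coord j v| * ‖w j‖
      ≤ (1 / 2) ^ 0 * (1 / 4) ^ j * N (tailProj b 0 v) * 1 := by
        gcongr
        exacts [abs_coordWeight_mul_le hb hcont j.zero_le v, hw j]
    _ ≤ (1 / 2) ^ 0 * (1 / 4) ^ j * (C * ‖v‖) * 1 := by
        gcongr
        exact (hb.tailProj_le 0 v).trans (h v).2
    _ = C * (1 / 4) ^ j * ‖v‖ := by ring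

theorem hasSum_weightedMap (x : E) :
    HasSum (fun j => (coordWeight N b j * b.coord j x) • w j) (weightedMap N b w x) := by
  have hsum := (ContinuousLinearMap.apply ℝ F x).hasSum
    (summable_coordWeight_smul_smulRight hb hN hw).hasSum
  exact hsum

theorem weightedMap_basis (j : ℕ) : weightedMap N b w (b j) = coordWeight N b j • w j := by
  refine (hasSum_weightedMap hb hN hw (b j)).unique ?_
  have hsingle := hasSum_single (f := fun l => (coordWeight N b l * b.coord l (b j)) • w l) j
    fun l hl => by rw [coord_basis_of_ne b hl, mul_zero, zero_smul]
  rwa [coord_basis_self, mul_one] at hsingle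

theorem norm_weightedMap_tailProj_le {m k : ℕ} (hmk : m ≤ k) (x : E) :
    ‖weightedMap N b w (tailProj b k x)‖ ≤ 2 * (1 / 2) ^ m * N (tailProj b m x) := by
  have hterm : ∀ j, ‖(coordWeight N b j * b.coord j (tailProj b k x)) • w j‖
      ≤ (1 / 2) ^ m * N (tailProj b m x) * (1 / 2) ^ j := by
    intro j
    rw [coord_tailProj]
    split_ifs with h
    · rw [norm_smul, Real.norm_eq_abs]
      calc |coordWeight N b j * b.coord j x| * ‖w j‖
          ≤ (1 / 2) ^ m * (1 / 4) ^ j * N (tailProj b m x) * 1 := by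
            gcongr
            exacts [abs_coordWeight_mul_le hb hN.continuous (hmk.trans h) x, hw j]
        _ ≤ (1 / 2) ^ m * (1 / 2) ^ j * N (tailProj b m x) * 1 := by
            gcongr
            norm_num
        _ = (1 / 2) ^ m * N (tailProj b m x) * (1 / 2) ^ j := by ring
    · rw [mul_zero, zero_smul, norm_zero]
      positivity
  have hle := (hasSum_weightedMap hb hN hw (tailProj b k x)).norm_le_of_bounded
    (hasSum_geometric_two.mul_left ((1 / 2) ^ m * N (tailProj b m x))) hterm
  linarith

end Bounds

end WeightedMap

section Gates

variable {E : Type*} [NormedAddCommGroup E] [NormedSpace ℝ E] {N : Seminorm ℝ E}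
  {b : SchauderBasis ℝ E} {L : ℝ} {τ : ℕ → E → ℝ} {j : ℕ} {x : E}

/-- A smooth gate that opens when the radius ratio crosses the window `(8 + 2⁻ʲ, 8 + 2 · 2⁻ʲ)`. The
windows are disjoint, so that at most one gate moves at a given point. -/
noncomputable def gate (N : Seminorm ℝ E) (b : SchauderBasis ℝ E) (τ : ℕ → E → ℝ) (j : ℕ)
    (x : E) : ℝ :=
  Real.smoothTransition (2 ^ j * (radiusRatio N b τ j x - 8) - 1)

/-- The derivative of the gate with respect to the radius ratio. -/
noncomputable def gateSlope (N : Seminorm ℝ E) (b : SchauderBasis ℝ E) (τ : ℕ → E → ℝ) (j : ℕ)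
    (x : E) : ℝ :=
  deriv Real.smoothTransition (2 ^ j * (radiusRatio N b τ j x - 8) - 1) * 2 ^ j

theorem abs_gate_le_one : |gate N b τ j x| ≤ 1 :=
  (abs_of_nonneg (Real.smoothTransition.nonneg _)).trans_le (Real.smoothTransition.le_one _)

theorem abs_gateSlope_le {c : ℝ} (hc : ∀ s, |deriv Real.smoothTransition s| ≤ c) :
    |gateSlope N b τ j x| ≤ c * 2 ^ j := by
  rw [gateSlope, abs_mul, abs_of_nonneg (a := (2 : ℝ) ^ j) (by positivity)]
  gcongr
  exact hc _

theorem gate_eq_zero (h : radiusRatio N b τ j x ≤ 8) : gate N b τ j x = 0 := by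
  have hnonpos : 2 ^ j * (radiusRatio N b τ j x - 8) ≤ 0 :=
    mul_nonpos_of_nonneg_of_nonpos (by positivity) (by linarith)
  exact Real.smoothTransition.zero_of_nonpos (by linarith)

theorem two_le_pow_mul (h : 10 ≤ radiusRatio N b τ j x) :
    2 ≤ 2 ^ j * (radiusRatio N b τ j x - 8) :=
  (by linarith : 2 ≤ radiusRatio N b τ j x - 8).trans <|
    le_mul_of_one_le_left (by linarith) (one_le_pow₀ one_le_two)

theorem gate_eq_one (h : 10 ≤ radiusRatio N b τ j x) : gate N b τ j x = 1 :=
  Real.smoothTransition.one_of_one_le (by linarith [two_le_pow_mul h])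

theorem window_of_gateSlope_ne_zero (h : gateSlope N b τ j x ≠ 0) :
    2 ^ j * (radiusRatio N b τ j x - 8) ∈ Ioo 1 2 := by
  have hderiv := left_ne_zero_of_mul h
  constructor <;> by_contra! hle
  · exact hderiv (deriv_smoothTransition_of_nonpos (by linarith))
  · exact hderiv (deriv_smoothTransition_of_one_le (by linarith))

theorem radiusRatio_of_gateSlope_ne_zero (h : gateSlope N b τ j x ≠ 0) :
    radiusRatio N b τ j x ∈ Ioo 8 10 := by
  obtain ⟨hlow, hupp⟩ := window_of_gateSlope_ne_zero h
  constructor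
  · exact sub_pos.1 ((mul_pos_iff_of_pos_left (by positivity)).1 (zero_lt_one.trans hlow))
  · by_contra! hle
    exact hupp.not_ge (two_le_pow_mul hle)

namespace IsRadiusFamily

variable (hτ : IsRadiusFamily N L τ)
include hτ

theorem not_lt_of_gateSlope_ne_zero (hb : IsOneSuppressionUnconditional N b) {l : ℕ}
    (hj : gateSlope N b τ j x ≠ 0) (hl : gateSlope N b τ l x ≠ 0) : ¬ j < l := by
  intro hjl
  have h8 := (radiusRatio_of_gateSlope_ne_zero hj).1
  have hmono := hτ.radiusRatio_mono hb hjl.le (by linarith : 2 ≤ radiusRatio N b τ j x)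
  have hpow : (2 : ℝ) ^ j * 2 ≤ 2 ^ l := by
    rw [← pow_succ]
    exact pow_le_pow_right₀ one_le_two hjl
  have hmul := mul_le_mul hpow (sub_le_sub_right hmono 8) (by linarith) (by positivity)
  linarith [(window_of_gateSlope_ne_zero hj).1, (window_of_gateSlope_ne_zero hl).2]

theorem eq_of_gateSlope_ne_zero (hb : IsOneSuppressionUnconditional N b) {l : ℕ}
    (hj : gateSlope N b τ j x ≠ 0) (hl : gateSlope N b τ l x ≠ 0) : j = l :=
  le_antisymm (not_lt.1 (hτ.not_lt_of_gateSlope_ne_zero hb hl hj))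
    (not_lt.1 (hτ.not_lt_of_gateSlope_ne_zero hb hj hl))

variable (hN : IsEquivalentNorm N) (hC : IsC1Norm N)
include hN hC

theorem contDiff_gate (j : ℕ) : ContDiff ℝ 1 (gate N b τ j) :=
  Real.smoothTransition.contDiff.comp
    ((contDiff_const.mul ((hτ.contDiff_radiusRatio hN hC j).sub contDiff_const)).sub
      contDiff_const)

theorem hasFDerivAt_gate (j : ℕ) (x : E) :
    HasFDerivAt (gate N b τ j) (gateSlope N b τ j x • fderiv ℝ (radiusRatio N b τ j) x) x := by
  rw [gateSlope, mul_smul]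
  exact (hasDerivAt_smoothTransition (2 ^ j * (radiusRatio N b τ j x - 8) - 1)).comp_hasFDerivAt x
    ((((hτ.hasFDerivAt_radiusRatio (b := b) hN hC j x).sub_const 8).const_mul
      ((2 : ℝ) ^ j)).sub_const 1)

end IsRadiusFamily

theorem IsFirstDominated.abs_gateSlope_mul_fderiv_radiusRatio_le {m : ℕ}
    (h : IsFirstDominated N b τ m x) (hτ : IsRadiusFamily N L τ)
    (hb : IsOneSuppressionUnconditional N b) (hN : IsEquivalentNorm N) (hC : IsC1Norm N) {c : ℝ}
    (hc1 : 1 ≤ c) (hc : ∀ s, |deriv Real.smoothTransition s| ≤ c) (hL0 : 0 ≤ L)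
    (hL : 16 * c * L ≤ 1) (hj : m ≤ j) (v : E) :
    |gateSlope N b τ j x * fderiv ℝ (radiusRatio N b τ j) x v|
      ≤ 260 * c * 2 ^ j * N v / tailSize N b m x := by
  have ht := tailSize_pos (N := N) (b := b) m x
  have : 0 ≤ c := zero_le_one.trans hc1
  by_cases hslope : gateSlope N b τ j x = 0
  · rw [hslope, zero_mul, abs_zero]
    positivity
  have hratio := h.abs_fderiv_radiusRatio_le hτ hN hC hb hL0
    (by linarith [mul_le_mul_of_nonneg_right hc1 hL0]) hj
    (radiusRatio_of_gateSlope_ne_zero hslope).2.le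
    (h.fderiv_frozenSum_le hτ hN hC hb hc1 hc hL0 hL j v)
  rw [abs_mul]
  calc _ ≤ c * 2 ^ j * (2 * 10 * (L * (34 * c) + 10) * N v / tailSize N b m x) := by
        gcongr
        exact abs_gateSlope_le hc
    _ ≤ c * 2 ^ j * (2 * 10 * (3 + 10) * N v / tailSize N b m x) := by
        gcongr
        linarith
    _ = 260 * c * 2 ^ j * N v / tailSize N b m x := by ring

end Gates

section GatedMap

variable {E F : Type*} [NormedAddCommGroup E] [NormedSpace ℝ E] [NormedAddCommGroup F]
  [NormedSpace ℝ F] {N : Seminorm ℝ E} {b : SchauderBasis ℝ E} {w : ℕ → F} {L : ℝ} {τ : ℕ → E → ℝ}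

/-- The weighted map with the coordinates of index less than `K` gated. -/
noncomputable def gatedMap (N : Seminorm ℝ E) (b : SchauderBasis ℝ E) (τ : ℕ → E → ℝ)
    (w : ℕ → F) (K : ℕ) (x : E) : F :=
  ∑ j ∈ Finset.range K, (gate N b τ j x * (coordWeight N b j * b.coord j x)) • w j
    + weightedMap N b w (tailProj b K x)

namespace IsRadiusFamily

variable (hτ : IsRadiusFamily N L τ) (hN : IsEquivalentNorm N)
include hτ hN

theorem gatedMap_eq [CompleteSpace F] (hb : IsOneSuppressionUnconditional N b)
    (hw : ∀ j, ‖w j‖ ≤ 1) {K l : ℕ} (h : K ≤ l) {x : E} (hx : 10 ≤ radiusRatio N b τ K x) :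
    gatedMap N b τ w l x = gatedMap N b τ w K x := by
  induction l, h using Nat.le_induction with
  | base => rfl
  | succ l hl ih =>
    have hopen : gate N b τ l x = 1 :=
      gate_eq_one (hx.trans (hτ.radiusRatio_mono hb hl (by linarith)))
    rw [← ih, gatedMap, gatedMap, Finset.sum_range_succ, hopen, tailProj_succ, map_sub, map_smul,
      weightedMap_basis hb hN hw]
    module

variable (hC : IsC1Norm N)
include hC

theorem contDiff_gatedMap (K : ℕ) : ContDiff ℝ 1 (gatedMap N b τ w K) :=
  (ContDiff.sum fun j _ => ((hτ.contDiff_gate hN hC j).mul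
    (contDiff_const.mul (b.coord j).contDiff)).smul contDiff_const).add
      ((weightedMap N b w).comp (tailProj b K)).contDiff

theorem fderiv_gatedMap_apply (K : ℕ) (x v : E) :
    fderiv ℝ (gatedMap N b τ w K) x v =
      ∑ j ∈ Finset.range K, (gate N b τ j x * (coordWeight N b j * b.coord j v)
        + gateSlope N b τ j x * fderiv ℝ (radiusRatio N b τ j) x v *
          (coordWeight N b j * b.coord j x)) • w j + weightedMap N b w (tailProj b K v) := by
  have hderiv : HasFDerivAt (gatedMap N b τ w K) _ x :=
    (HasFDerivAt.fun_sum (u := Finset.range K) fun j _ =>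
      ((hτ.hasFDerivAt_gate (b := b) hN hC j x).mul
        ((b.coord j).hasFDerivAt.const_mul (coordWeight N b j))).smul_const (w j)).add
      ((weightedMap N b w).comp (tailProj b K)).hasFDerivAt
  rw [hderiv.fderiv]
  simp only [add_apply, smul_apply, smul_eq_mul, ContinuousLinearMap.smulRight_apply, sum_apply,
    ContinuousLinearMap.comp_apply]
  congr 1
  refine Finset.sum_congr rfl fun j _ => ?_
  congr 1
  ring

end IsRadiusFamily

namespace IsFirstDominated

variable {m : ℕ} {x : E} (h : IsFirstDominated N b τ m x) (hb : IsOneSuppressionUnconditional N b)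
  (hN : IsEquivalentNorm N)
include h hb hN

theorem abs_gate_mul_le (j : ℕ) (v : E) :
    |gate N b τ j x * (coordWeight N b j * b.coord j v)|
      ≤ (1 / 2) ^ m * (1 / 2) ^ j * N (tailProj b m v) := by
  rcases lt_or_ge j m with hj | hj
  · rw [gate_eq_zero (by linarith [h.1 j hj]), zero_mul, abs_zero]
    positivity
  · rw [abs_mul]
    calc |gate N b τ j x| * |coordWeight N b j * b.coord j v|
        ≤ 1 * ((1 / 2) ^ m * (1 / 4) ^ j * N (tailProj b m v)) := by
          gcongr
          exacts [abs_gate_le_one, abs_coordWeight_mul_le hb hN.continuous hj v]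
      _ ≤ (1 / 2) ^ m * (1 / 2) ^ j * N (tailProj b m v) := by
          rw [one_mul]
          gcongr
          norm_num

theorem abs_gateSlope_mul_le (hτ : IsRadiusFamily N L τ) (hC : IsC1Norm N) {c : ℝ} (hc1 : 1 ≤ c)
    (hc : ∀ s, |deriv Real.smoothTransition s| ≤ c) (hL0 : 0 ≤ L) (hL : 16 * c * L ≤ 1) (j : ℕ)
    (v : E) :
    |gateSlope N b τ j x * fderiv ℝ (radiusRatio N b τ j) x v * (coordWeight N b j * b.coord j x)|
      ≤ 260 * c * ((1 / 2) ^ m * (1 / 2) ^ j) * N v := by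
  have : 0 ≤ c := zero_le_one.trans hc1
  rcases lt_or_ge j m with hj | hj
  · have hslope : gateSlope N b τ j x = 0 := by
      by_contra hne
      linarith [(radiusRatio_of_gateSlope_ne_zero hne).1, h.1 j hj]
    rw [hslope, zero_mul, zero_mul, abs_zero]
    positivity
  have ht := tailSize_pos (N := N) (b := b) m x
  rw [abs_mul]
  calc _ ≤ 260 * c * 2 ^ j * N v / tailSize N b m x *
          ((1 / 2) ^ m * (1 / 4) ^ j * tailSize N b m x) := by
        gcongr
        · exact h.abs_gateSlope_mul_fderiv_radiusRatio_le hτ hb hN hC hc1 hc hL0 hL hj v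
        · exact (abs_coordWeight_mul_le hb hN.continuous hj x).trans
            (by gcongr; exact tailProj_le_tailSize m x)
    _ = 260 * c * ((1 / 2) ^ m * (2 * (1 / 4)) ^ j) * N v := by rw [mul_pow]; field_simp
    _ = 260 * c * ((1 / 2) ^ m * (1 / 2) ^ j) * N v := by norm_num

variable [CompleteSpace F] (hw : ∀ j, ‖w j‖ ≤ 1) {K : ℕ} (hK : m ≤ K)
include hw hK

theorem norm_gatedMap_le : ‖gatedMap N b τ w K x‖ ≤ 4 * (1 / 2) ^ m * N (tailProj b m x) := by
  have hsum := norm_sum_smul_le hw (B := (1 / 2) ^ m * N (tailProj b m x)) (K := K) (by positivity)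
    fun j => (h.abs_gate_mul_le hb hN j x).trans_eq (mul_right_comm _ _ _)
  have htail := norm_weightedMap_tailProj_le hb hN hw hK x
  rw [gatedMap]
  linarith [norm_add_le_of_le hsum htail]

theorem norm_fderiv_gatedMap_le (hτ : IsRadiusFamily N L τ) (hC : IsC1Norm N) {c : ℝ}
    (hc1 : 1 ≤ c) (hc : ∀ s, |deriv Real.smoothTransition s| ≤ c) (hL0 : 0 ≤ L)
    (hL : 16 * c * L ≤ 1) (v : E) :
    ‖fderiv ℝ (gatedMap N b τ w K) x v‖ ≤ 524 * c * (1 / 2) ^ m * N v := by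
  have hvc : N v ≤ c * N v := le_mul_of_one_le_left (apply_nonneg N v) hc1
  have hterm : ∀ j, |gate N b τ j x * (coordWeight N b j * b.coord j v)
      + gateSlope N b τ j x * fderiv ℝ (radiusRatio N b τ j) x v *
        (coordWeight N b j * b.coord j x)| ≤ 261 * c * (1 / 2) ^ m * N v * (1 / 2) ^ j := by
    intro j
    calc _ ≤ (1 / 2) ^ m * (1 / 2) ^ j * (c * N v)
          + 260 * c * ((1 / 2) ^ m * (1 / 2) ^ j) * N v := by
          refine (abs_add_le _ _).trans (add_le_add ((h.abs_gate_mul_le hb hN j v).trans ?_)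
            (h.abs_gateSlope_mul_le hb hN hτ hC hc1 hc hL0 hL j v))
          gcongr
          exact (hb.tailProj_le m v).trans hvc
      _ = 261 * c * (1 / 2) ^ m * N v * (1 / 2) ^ j := by ring
  have : 0 ≤ c := zero_le_one.trans hc1
  have hsum := norm_sum_smul_le hw (K := K) (by positivity) hterm
  have htail : ‖weightedMap N b w (tailProj b K v)‖ ≤ 2 * (1 / 2) ^ m * (c * N v) :=
    (norm_weightedMap_tailProj_le hb hN hw hK v).trans
      (by gcongr; exact (hb.tailProj_le m v).trans hvc)
  rw [hτ.fderiv_gatedMap_apply hN hC]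
  linarith [norm_add_le_of_le hsum htail]

end IsFirstDominated

end GatedMap

section CoordinateSubspace

/-- The subspace of the vectors whose coordinates with index in `A` vanish. -/
def coordSubspace {𝕜 E : Type*} [NontriviallyNormedField 𝕜] [NormedAddCommGroup E]
    [NormedSpace 𝕜 E] (b : SchauderBasis 𝕜 E) (A : Set ℕ) : Submodule 𝕜 E :=
  ⨅ j ∈ A, (b.coord j).ker

section General

variable {𝕜 E : Type*} [NontriviallyNormedField 𝕜] [NormedAddCommGroup E] [NormedSpace 𝕜 E]
  {b : SchauderBasis 𝕜 E} {A : Set ℕ}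

theorem mem_coordSubspace {x : E} : x ∈ coordSubspace b A ↔ ∀ j ∈ A, b.coord j x = 0 := by
  simp [coordSubspace]

theorem not_finiteDimensional_quotient_coordSubspace (hA : A.Infinite) :
    ¬ FiniteDimensional 𝕜 (E ⧸ coordSubspace b A) := by
  intro _
  have hli : LinearIndependent 𝕜 fun j : A => (coordSubspace b A).mkQ (b j) :=
    LinearIndependent.of_pairwise_dual_eq_zero_one _
      (fun j => (coordSubspace b A).liftQ (b.coord j : E →ₗ[𝕜] 𝕜)
        fun _ hx => LinearMap.mem_ker.2 (mem_coordSubspace.1 hx j j.2))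
      (fun _ _ hij => coord_basis_of_ne b fun h => hij (Subtype.ext h))
      fun j => coord_basis_self b j
  exact hA (Set.finite_coe_iff.1 hli.finite)

end General

variable {E : Type*} [NormedAddCommGroup E] [NormedSpace ℝ E] {N : Seminorm ℝ E}
  {b : SchauderBasis ℝ E} (A : Set ℕ)

variable (hb : IsOneSuppressionUnconditional N b) (hN : IsEquivalentNorm N)
include hb hN

theorem cauchySeq_sum_indicator (x : E) :
    CauchySeq fun n => ∑ j ∈ Finset.range n, (A.indicator 1 j * b.coord j x) • b j := by
  have hcont := hN.continuous
  obtain ⟨c, _, hc, _, h⟩ := hN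
  refine cauchySeq_of_le_tendsto_0' (fun n => N (tailProj b n x) / c) (fun n m hnm => ?_) ?_
  · rw [dist_comm, dist_eq_norm, ← Finset.sum_Ico_eq_sub _ hnm, le_div_iff₀ hc, mul_comm]
    refine (h _).1.trans (hb.sum_le_tailProj hcont _ (fun l hl hlt => ?_) (fun l _ => ?_)
      (fun l _ => ?_) x)
    · exact absurd hlt (Finset.mem_Ico.1 hl).1.not_gt
    · exact Set.indicator_nonneg (fun _ _ => zero_le_one) l
    · exact Set.indicator_le_self' (fun _ _ => zero_le_one) l
  · have hlim := ((hcont.tendsto 0).comp (tendsto_tailProj b x)).div_const c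
    rwa [map_zero, zero_div] at hlim

variable [CompleteSpace E]

theorem exists_coordProjection :
    ∃ P : E →L[ℝ] E, (∀ x, ∀ j ∈ A, b.coord j (P x) = b.coord j x) ∧
      ∀ x ∈ coordSubspace b A, P x = 0 := by
  choose q hq using fun x => cauchySeq_tendsto_of_complete (cauchySeq_sum_indicator A hb hN x)
  let p : ℕ → E →L[ℝ] E := fun n =>
    ∑ j ∈ Finset.range n, (A.indicator (1 : ℕ → ℝ) j • b.coord j).smulRight (b j)
  have hp : ∀ n x, p n x = ∑ j ∈ Finset.range n, (A.indicator 1 j * b.coord j x) • b j := by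
    intro n x
    simp [p]
  have hlim : Tendsto (fun n x => p n x) atTop (𝓝 q) :=
    tendsto_pi_nhds.2 fun x => by simpa only [hp] using hq x
  refine ⟨continuousLinearMapOfTendsto p hlim, ?_, ?_⟩
  · intro x j hj
    refine tendsto_nhds_unique (((b.coord j).continuous.tendsto _).comp (hq x)) ?_
    refine tendsto_const_nhds.congr' (eventually_atTop.2 ⟨j + 1, fun n hn => ?_⟩)
    rw [Function.comp_apply, coord_sum_smul, if_pos (Finset.mem_range.2 hn),
      Set.indicator_of_mem hj, Pi.one_apply, one_mul]
  · intro x hx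
    refine tendsto_nhds_unique (hq x) (tendsto_const_nhds.congr fun n => ?_)
    refine (Finset.sum_eq_zero fun j _ => ?_).symm
    by_cases hj : j ∈ A
    · rw [mem_coordSubspace.1 hx j hj, mul_zero, zero_smul]
    · rw [Set.indicator_of_notMem hj, zero_mul, zero_smul]

theorem closedComplemented_coordSubspace : (coordSubspace b A).ClosedComplemented := by
  obtain ⟨P, hcoord, hzero⟩ := exists_coordProjection A hb hN
  refine ⟨(ContinuousLinearMap.id ℝ E - P).codRestrict _ fun x => mem_coordSubspace.2 ?_,
    fun x => Subtype.ext ?_⟩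
  · intro j hj
    rw [sub_apply, ContinuousLinearMap.id_apply, map_sub, hcoord x j hj, sub_self]
  · change (x : E) - P x = x
    rw [hzero x x.2, sub_zero]

end CoordinateSubspace

section Critical

variable {E F : Type*} [NormedAddCommGroup E] [NormedSpace ℝ E] [NormedAddCommGroup F]
  [NormedSpace ℝ F] {N : Seminorm ℝ E} {b : SchauderBasis ℝ E} {w : ℕ → F} {L : ℝ} {τ : ℕ → E → ℝ}

/-- The coefficient with which the motion of the `l`-th gate enters the functional
`φ ∘ D (gatedMap N b τ w K) x`. -/
noncomputable def gateCoeff (N : Seminorm ℝ E) (b : SchauderBasis ℝ E) (τ : ℕ → E → ℝ) (w : ℕ → F)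
    (φ : F →L[ℝ] ℝ) (x : E) (l : ℕ) : ℝ :=
  gateSlope N b τ l x * (coordWeight N b l * b.coord l x * φ (w l)) / tailSize N b l x

theorem gateSlope_ne_zero_of_gateCoeff_ne_zero {φ : F →L[ℝ] ℝ} {x : E} {l : ℕ}
    (h : gateCoeff N b τ w φ x l ≠ 0) : gateSlope N b τ l x ≠ 0 := fun h0 =>
  h (by rw [gateCoeff, h0, zero_mul, zero_div])

theorem le_of_gateSlope_ne_zero {x : E} {l m : ℕ}
    (hm : IsLeast {k | 2 ≤ radiusRatio N b τ k x} m) (h : gateSlope N b τ l x ≠ 0) : m ≤ l := by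
  have h2 : 2 ≤ radiusRatio N b τ l x := by linarith [(radiusRatio_of_gateSlope_ne_zero h).1]
  exact hm.2 h2

namespace IsRadiusFamily

variable (hτ : IsRadiusFamily N L τ) (hb : IsOneSuppressionUnconditional N b)
  (hN : IsEquivalentNorm N) (hC : IsC1Norm N) {x : E} {m : ℕ}
  (hm : IsLeast {k | 2 ≤ radiusRatio N b τ k x} m)
include hτ hb hN hC

section Relations

include hm

theorem apply_fderiv_gatedMap (φ : F →L[ℝ] ℝ) (K : ℕ) (v : E) :
    φ (fderiv ℝ (gatedMap N b τ w K) x v) =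
      ∑ l ∈ Finset.range K, gate N b τ l x * (coordWeight N b l * b.coord l v) * φ (w l)
      + ∑ l ∈ Finset.range K, gateCoeff N b τ w φ x l *
        (fderiv ℝ (τ l) (frozenSum N b τ l x) (fderiv ℝ (frozenSum N b τ m) x v)
          - radiusRatio N b τ l x * fderiv ℝ (tailSize N b l) x v)
      + φ (weightedMap N b w (tailProj b K v)) := by
  rw [hτ.fderiv_gatedMap_apply hN hC, map_add, map_sum, ← Finset.sum_add_distrib]
  congr 1
  refine Finset.sum_congr rfl fun l _ => ?_
  rw [map_smul, smul_eq_mul, add_mul, gateCoeff]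
  congr 1
  by_cases hs : gateSlope N b τ l x = 0
  · simp only [hs, zero_mul, zero_div]
  · rw [hτ.fderiv_radiusRatio_apply hN hC,
      hτ.fderiv_frozenSum_eq hN hC hb (le_of_gateSlope_ne_zero hm hs) hm.1]
    ring

variable {K : ℕ} (hK : 2 ≤ radiusRatio N b τ K x)
  {ψ : E →L[ℝ] ℝ} {φ : F →L[ℝ] ℝ}
  (h0 : ∀ v, ψ (fderiv ℝ (frozenSum N b τ K) x v) + φ (fderiv ℝ (gatedMap N b τ w K) x v) = 0)
include hK h0

theorem relation_of_critical (v : E) :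
    (ψ + ∑ l ∈ Finset.range K, gateCoeff N b τ w φ x l • fderiv ℝ (τ l) (frozenSum N b τ l x))
        (fderiv ℝ (frozenSum N b τ m) x v)
      + ∑ l ∈ Finset.range K, gate N b τ l x * (coordWeight N b l * b.coord l v) * φ (w l)
      + φ (weightedMap N b w (tailProj b K v)) =
    ∑ l ∈ Finset.range K, gateCoeff N b τ w φ x l *
      (radiusRatio N b τ l x * fderiv ℝ (tailSize N b l) x v) := by
  have hv := h0 v
  rw [hτ.fderiv_frozenSum_eq hN hC hb (hm.2 hK) hm.1, hτ.apply_fderiv_gatedMap hb hN hC hm] at hv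
  simp only [mul_sub, Finset.sum_sub_distrib] at hv
  simp only [add_apply, sum_apply, smul_apply, smul_eq_mul]
  linarith

theorem add_sum_fderiv_frozenSum_eq_zero (v : E) :
    (ψ + ∑ l ∈ Finset.range K, gateCoeff N b τ w φ x l • fderiv ℝ (τ l) (frozenSum N b τ l x))
      (fderiv ℝ (frozenSum N b τ m) x v) = 0 := by
  have hlt : ∀ l < m, radiusRatio N b τ l x < 2 := fun l hl =>
    not_le.1 fun hle => hl.not_ge (hm.2 hle)
  refine hτ.comp_fderiv_frozenSum_eq_zero hN hC hb hlt (fun j hj => ?_) v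
  have hgate : ∀ l, gate N b τ l x * (coordWeight N b l * b.coord l (b j)) * φ (w l) = 0 := by
    intro l
    rcases eq_or_ne l j with rfl | hl
    · rw [gate_eq_zero (by linarith [hlt l hj]), zero_mul, zero_mul]
    · rw [coord_basis_of_ne b hl, mul_zero, mul_zero, zero_mul]
  have hmove : ∀ l, gateCoeff N b τ w φ x l *
      (radiusRatio N b τ l x * fderiv ℝ (tailSize N b l) x (b j)) = 0 := by
    intro l
    by_cases hl : gateCoeff N b τ w φ x l = 0
    · rw [hl, zero_mul]
    · rw [fderiv_tailSize_basis_of_lt hN hC (hj.trans_le (le_of_gateSlope_ne_zero hm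
        (gateSlope_ne_zero_of_gateCoeff_ne_zero hl))), mul_zero, mul_zero]
  have hrel := hτ.relation_of_critical hb hN hC hm hK h0 (b j)
  rwa [Finset.sum_eq_zero fun l _ => hgate l, Finset.sum_eq_zero fun l _ => hmove l, add_zero,
    tailProj_basis_of_lt b (hj.trans_le (hm.2 hK)), map_zero, map_zero, add_zero] at hrel

variable [CompleteSpace F] (hw : ∀ j, ‖w j‖ ≤ 1)
include hw

theorem coordWeight_mul_apply_eq_sum {j : ℕ} (hj : K ≤ j) :
    coordWeight N b j * φ (w j) = ∑ l ∈ Finset.range K,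
      gateCoeff N b τ w φ x l * (radiusRatio N b τ l x * fderiv ℝ (tailSize N b l) x (b j)) := by
  have hgate : ∀ l ∈ Finset.range K,
      gate N b τ l x * (coordWeight N b l * b.coord l (b j)) * φ (w l) = 0 := by
    intro l hl
    rw [coord_basis_of_ne b ((Finset.mem_range.1 hl).trans_le hj).ne, mul_zero, mul_zero, zero_mul]
  rw [← hτ.relation_of_critical hb hN hC hm hK h0,
    hτ.add_sum_fderiv_frozenSum_eq_zero hb hN hC hm hK h0, Finset.sum_eq_zero hgate,
    tailProj_basis_of_le b hj, weightedMap_basis hb hN hw, map_smul, smul_eq_mul, add_zero,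
    zero_add]

end Relations

theorem coord_eq_zero_of_critical [CompleteSpace F] (hS : IsStrictlyConvexNorm N)
    (hw : ∀ j, ‖w j‖ ≤ 1) {K : ℕ} (hK : 2 ≤ radiusRatio N b τ K x) {ψ : E →L[ℝ] ℝ}
    {φ : F →L[ℝ] ℝ}
    (h0 : ∀ v, ψ (fderiv ℝ (frozenSum N b τ K) x v) + φ (fderiv ℝ (gatedMap N b τ w K) x v) = 0)
    {i : ℕ} (hi : K ≤ i) (hφ : φ (w i) ≠ 0) {j : ℕ} (hj : K ≤ j) (hwj : w j = 0) :
    b.coord j x = 0 := by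
  have hm : IsLeast {k | 2 ≤ radiusRatio N b τ k x} (sInf {k | 2 ≤ radiusRatio N b τ k x}) :=
    ⟨Nat.sInf_mem ⟨K, hK⟩, fun _ hk => Nat.sInf_le hk⟩
  have hsum := fun {j} (hj : K ≤ j) =>
    hτ.coordWeight_mul_apply_eq_sum hb hN hC hm hK h0 hw hj
  obtain ⟨l, hl, hterm⟩ := Finset.exists_ne_zero_of_sum_ne_zero
    ((hsum hi).symm.trans_ne (mul_ne_zero (coordWeight_pos hN i).ne' hφ))
  have hcoeff := left_ne_zero_of_mul hterm
  have hslope := gateSlope_ne_zero_of_gateCoeff_ne_zero hcoeff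
  have honly : ∀ k ∈ Finset.range K, k ≠ l → gateCoeff N b τ w φ x k *
      (radiusRatio N b τ k x * fderiv ℝ (tailSize N b k) x (b j)) = 0 := by
    intro k _ hkl
    by_contra hne
    exact hkl (hτ.eq_of_gateSlope_ne_zero hb
      (gateSlope_ne_zero_of_gateCoeff_ne_zero (left_ne_zero_of_mul hne)) hslope)
  have hzero := hsum hj
  rw [hwj, map_zero, mul_zero, Finset.sum_eq_single_of_mem l hl honly] at hzero
  have hratio : radiusRatio N b τ l x ≠ 0 := left_ne_zero_of_mul (right_ne_zero_of_mul hterm)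
  have hderiv : fderiv ℝ (tailSize N b l) x (b j) = 0 :=
    (mul_eq_zero.1 ((mul_eq_zero.1 hzero.symm).resolve_left hcoeff)).resolve_left hratio
  exact coord_eq_zero_of_fderiv_tailSize_eq_zero hN hC hb hS
    ((Finset.mem_range.1 hl).le.trans hj) hderiv

end IsRadiusFamily

end Critical

section DyadicSum

variable {α : Type*}

/-- The weighted sums `∑ i < k, 2⁻⁽ⁱ⁺¹⁾ h i`; their weights add up to at most `1`, so they inherit
Lipschitz constants from the `h i` and are dominated by some `h i`. -/
noncomputable def dyadicSum (h : ℕ → α → ℝ) (k : ℕ) (y : α) : ℝ :=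
  ∑ i ∈ Finset.range k, (1 / 2) ^ (i + 1) * h i y

theorem sum_range_half_pow_succ_le (k : ℕ) : ∑ i ∈ Finset.range k, (1 / 2 : ℝ) ^ (i + 1) ≤ 1 := by
  simp_rw [pow_succ]
  rw [← Finset.sum_mul]
  linarith [sum_geometric_two_le k]

theorem exists_dyadicSum_le {h : ℕ → α → ℝ} {k : ℕ} {y : α} (hy : 0 < dyadicSum h k y) :
    ∃ i, dyadicSum h k y ≤ h i y := by
  have hne : (Finset.range k).Nonempty := by
    by_contra hempty
    rw [dyadicSum, Finset.not_nonempty_iff_eq_empty.1 hempty, Finset.sum_empty] at hy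
    exact hy.false
  have hle : ∑ i ∈ Finset.range k, (1 / 2) ^ (i + 1) * dyadicSum h k y
      ≤ ∑ i ∈ Finset.range k, (1 / 2) ^ (i + 1) * h i y := by
    rw [← Finset.sum_mul]
    exact mul_le_of_le_one_left hy.le (sum_range_half_pow_succ_le k)
  obtain ⟨i, -, hi⟩ := Finset.exists_le_of_sum_le hne hle
  exact ⟨i, le_of_mul_le_mul_left hi (by positivity)⟩

theorem le_dyadicSum {h : ℕ → α → ℝ} (h0 : ∀ i y, 0 ≤ h i y) {i k : ℕ} (hik : i < k) (y : α) :
    (1 / 2) ^ (i + 1) * h i y ≤ dyadicSum h k y :=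
  Finset.single_le_sum (f := fun i => (1 / 2) ^ (i + 1) * h i y)
    (fun i _ => mul_nonneg (by positivity) (h0 i y)) (Finset.mem_range.2 hik)

end DyadicSum

section RadiusFamilies

variable {E : Type*} [NormedAddCommGroup E] [NormedSpace ℝ E] {N : Seminorm ℝ E} {L : ℝ}

theorem separableSpace_of_schauderBasis (b : SchauderBasis ℝ E) :
    TopologicalSpace.SeparableSpace E := by
  rw [← TopologicalSpace.isSeparable_univ_iff]
  refine ((countable_range b).isSeparable.span (R := ℝ)).closure.mono fun x _ => ?_
  refine mem_closure_of_tendsto (SchauderBasis.tendsto_proj b x) (Eventually.of_forall fun n => ?_)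
  rw [SchauderBasis.proj_apply]
  exact Submodule.sum_mem _ fun j _ =>
    Submodule.smul_mem _ _ (Submodule.subset_span (mem_range_self j))

theorem isRadiusFamily_dyadicSum (hL : 0 ≤ L) {h : ℕ → E → ℝ} (hdiff : ∀ i, ContDiff ℝ 1 (h i))
    (h0 : ∀ i y, 0 ≤ h i y) (hadd : ∀ i y v, h i (y + v) ≤ h i y + L * N v) :
    IsRadiusFamily N L (dyadicSum h) where
  contDiff k := ContDiff.sum fun i _ => contDiff_const.mul (hdiff i)
  nonneg k y := Finset.sum_nonneg fun i _ => mul_nonneg (by positivity) (h0 i y)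
  mono y := monotone_nat_of_le_succ fun k => by
    rw [dyadicSum, dyadicSum, Finset.sum_range_succ]
    exact le_add_of_nonneg_right (mul_nonneg (by positivity) (h0 k y))
  add_le k y v :=
    calc dyadicSum h k (y + v)
        ≤ ∑ i ∈ Finset.range k, (1 / 2) ^ (i + 1) * (h i y + L * N v) :=
          Finset.sum_le_sum fun i _ => mul_le_mul_of_nonneg_left (hadd i y v) (by positivity)
      _ = dyadicSum h k y + (∑ i ∈ Finset.range k, (1 / 2 : ℝ) ^ (i + 1)) * (L * N v) := by
          simp_rw [mul_add, Finset.sum_add_distrib, Finset.sum_mul, dyadicSum]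
      _ ≤ dyadicSum h k y + L * N v :=
          add_le_add le_rfl (mul_le_of_le_one_left (mul_nonneg hL (apply_nonneg N v))
            (sum_range_half_pow_succ_le k))

theorem abs_smoothTransition_sub_le {c : ℝ} (hc : ∀ s, |deriv Real.smoothTransition s| ≤ c)
    (u v : ℝ) : |Real.smoothTransition (2 - 2 * v ^ 2) - Real.smoothTransition (2 - 2 * u ^ 2)|
      ≤ 4 * c * |v - u| := by
  have hc0 : 0 ≤ c := (abs_nonneg _).trans (hc 0)
  have hderiv : ∀ u : ℝ, HasDerivAt (fun u => Real.smoothTransition (2 - 2 * u ^ 2))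
      (deriv Real.smoothTransition (2 - 2 * u ^ 2) * -(2 * (2 * u))) u := fun u => by
    have hinner : HasDerivAt (fun u : ℝ => 2 - 2 * u ^ 2) (-(2 * (2 * u))) u := by
      simpa using ((hasDerivAt_pow 2 u).const_mul 2).const_sub 2
    exact (hasDerivAt_smoothTransition _).comp u hinner
  refine convex_univ.norm_image_sub_le_of_norm_hasDerivWithin_le (C := 4 * c)
    (fun u _ => (hderiv u).hasDerivWithinAt) (fun u _ => ?_) (mem_univ u) (mem_univ v)
  rw [norm_mul, Real.norm_eq_abs, Real.norm_eq_abs]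
  rcases le_or_gt |u| 1 with hu | hu
  · have hfactor : |-(2 * (2 * u))| ≤ 4 := by
      rw [abs_neg, abs_mul, abs_mul, abs_two]; linarith
    exact (mul_le_mul (hc _) hfactor (abs_nonneg _) hc0).trans_eq (mul_comm _ _)
  · have husq : 1 ≤ u ^ 2 := (one_lt_sq_iff_one_lt_abs u).2 hu |>.le
    rw [deriv_smoothTransition_of_nonpos (by linarith), abs_zero, zero_mul]
    positivity

/-- A bump function supported in the `N`-ball of centre `z` and radius `r` and equal to `1` on the
concentric ball of half the radius. -/
noncomputable def seminormBump (N : Seminorm ℝ E) (z : E) (r : ℝ) (y : E) : ℝ :=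
  Real.smoothTransition (2 - 2 * (N (y - z) / r) ^ 2)

theorem contDiff_seminormBump (hN : IsEquivalentNorm N) (hC : IsC1Norm N) (z : E) (r : ℝ) :
    ContDiff ℝ 1 (seminormBump N z r) := by
  have hsq : ContDiff ℝ 1 fun y => (N (y - z) / r) ^ 2 := by
    simp_rw [div_pow]
    exact ((hC.contDiff_sq hN).comp (contDiff_id.sub contDiff_const)).div_const _
  exact Real.smoothTransition.contDiff.comp (contDiff_const.sub (contDiff_const.mul hsq))

theorem lt_of_seminormBump_pos {z y : E} {r : ℝ} (hr : 0 < r) (h : 0 < seminormBump N z r y) :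
    N (y - z) < r := by
  contrapose! h
  have hone : 1 ≤ (N (y - z) / r) ^ 2 := one_le_pow₀ ((one_le_div hr).2 h)
  exact (Real.smoothTransition.zero_of_nonpos (by linarith)).le

theorem seminormBump_eq_one {z y : E} {r : ℝ} (hr : 0 < r) (h : N (y - z) < r / 2) :
    seminormBump N z r y = 1 := by
  have hhalf : N (y - z) / r ≤ 1 / 2 := by
    rw [div_le_iff₀ hr]; linarith
  have hsq : (N (y - z) / r) ^ 2 ≤ (1 / 2) ^ 2 :=
    pow_le_pow_left₀ (div_nonneg (apply_nonneg N _) hr.le) hhalf 2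
  exact Real.smoothTransition.one_of_one_le (by linarith)

theorem mul_seminormBump_add_le {c : ℝ} (hc : ∀ s, |deriv Real.smoothTransition s| ≤ c) {r : ℝ}
    (hr : 0 < r) (z y v : E) :
    r * seminormBump N z r (y + v) ≤ r * seminormBump N z r y + 4 * c * N v := by
  have hc0 : 0 ≤ c := (abs_nonneg _).trans (hc 0)
  have hdist : |N (y + v - z) - N (y - z)| ≤ N v := by
    simpa [add_sub_right_comm] using abs_sub_map_le_sub N (y + v - z) (y - z)
  have hbump : seminormBump N z r (y + v) - seminormBump N z r y ≤ 4 * c * (N v / r) :=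
    calc _ ≤ 4 * c * |N (y + v - z) / r - N (y - z) / r| :=
          (le_abs_self _).trans (abs_smoothTransition_sub_le hc _ _)
      _ ≤ 4 * c * (N v / r) := by
          rw [← sub_div, abs_div, abs_of_pos hr]
          gcongr
  have hmul := mul_le_mul_of_nonneg_left hbump hr.le
  rw [mul_left_comm, mul_div_cancel₀ _ hr.ne'] at hmul
  linarith

theorem exists_countable_ball_cover [SecondCountableTopology E] (hN : Continuous N) {U : Set E}
    (hU : U.Nonempty) {r : E → ℝ} (hr : ∀ z ∈ U, 0 < r z) :
    ∃ z : ℕ → E, (∀ i, z i ∈ U) ∧ ∀ x ∈ U, ∃ i, N (x - z i) < r (z i) := by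
  have hnhds : ∀ z ∈ U, {x | N (x - z) < r z} ∈ 𝓝[U] z := fun z hz =>
    mem_nhdsWithin_of_mem_nhds <| (hN.comp (continuous_sub_right z)).continuousAt.eventually
      (gt_mem_nhds (by simpa using hr z hz))
  obtain ⟨t, htU, htc, hcov⟩ := TopologicalSpace.countable_cover_nhdsWithin hnhds
  obtain ⟨x, hx⟩ := hU
  obtain ⟨z₀, hz₀, -⟩ := mem_iUnion₂.1 (hcov hx)
  obtain ⟨z, rfl⟩ := htc.exists_eq_range ⟨z₀, hz₀⟩
  refine ⟨z, fun i => htU (mem_range_self i), fun x hx => ?_⟩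
  obtain ⟨_, ⟨i, rfl⟩, h⟩ := mem_iUnion₂.1 (hcov hx)
  exact ⟨i, h⟩

/-- The dyadic sum of bumps supported in the `N`-balls of centre `z i` and radius `r i`, with
heights proportional to the radii so that all of them have the same Lipschitz constant. -/
noncomputable def bumpRadius (N : Seminorm ℝ E) (σ : ℝ) (z : ℕ → E) (r : ℕ → ℝ) : ℕ → E → ℝ :=
  dyadicSum fun i y => σ * (r i * seminormBump N (z i) (r i) y)

section BumpRadius

variable {σ : ℝ} (hσ : 0 < σ) {z : ℕ → E} {r : ℕ → ℝ} (hr : ∀ i, 0 < r i)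
include hσ hr

theorem scaled_seminormBump_nonneg (i : ℕ) (y : E) :
    0 ≤ σ * (r i * seminormBump N (z i) (r i) y) :=
  mul_nonneg hσ.le (mul_nonneg (hr i).le (Real.smoothTransition.nonneg _))

theorem isRadiusFamily_bumpRadius (hN : IsEquivalentNorm N) (hC : IsC1Norm N) {c : ℝ}
    (hc : ∀ s, |deriv Real.smoothTransition s| ≤ c) :
    IsRadiusFamily N (σ * (4 * c)) (bumpRadius N σ z r) := by
  have hc0 : 0 ≤ c := (abs_nonneg _).trans (hc 0)
  refine isRadiusFamily_dyadicSum (by positivity) (fun i => contDiff_const.mul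
    (contDiff_const.mul (contDiff_seminormBump hN hC _ _)))
    (scaled_seminormBump_nonneg hσ hr) fun i y v => ?_
  rw [mul_assoc, ← mul_add]
  exact mul_le_mul_of_nonneg_left (mul_seminormBump_add_le hc (hr i) _ y v) hσ.le

theorem eventually_le_bumpRadius (hN : Continuous N) {i : ℕ} {x : E} (hx : N (x - z i) < r i / 2) :
    ∀ᶠ y in 𝓝 x, ∀ k ≥ i + 1, (1 / 2) ^ (i + 1) * (σ * r i) ≤ bumpRadius N σ z r k y := by
  filter_upwards [(hN.comp (continuous_sub_right (z i))).continuousAt.eventually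
    (gt_mem_nhds hx)] with y hy k hk
  have hle := le_dyadicSum (scaled_seminormBump_nonneg (N := N) (z := z) hσ hr) hk y
  rwa [seminormBump_eq_one (hr i) hy, mul_one] at hle

theorem exists_bumpRadius_le (hσ1 : σ ≤ 1) {k : ℕ} {y : E} (hy : 0 < bumpRadius N σ z r k y) :
    ∃ i, N (y - z i) < r i ∧ bumpRadius N σ z r k y ≤ r i := by
  obtain ⟨i, hi⟩ := exists_dyadicSum_le hy
  have hbump : 0 < seminormBump N (z i) (r i) y :=
    pos_of_mul_pos_right (pos_of_mul_pos_right (hy.trans_le hi) hσ.le) (hr i).le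
  refine ⟨i, lt_of_seminormBump_pos (hr i) hbump, hi.trans ?_⟩
  exact (mul_le_of_le_one_left (mul_nonneg (hr i).le hbump.le) hσ1).trans
    (mul_le_of_le_one_right (hr i).le (Real.smoothTransition.le_one _))

end BumpRadius

theorem exists_isRadiusFamily [SecondCountableTopology E] (hN : IsEquivalentNorm N)
    (hC : IsC1Norm N) (hL : 0 < L) {U : Set E} {P : E → ℝ → Prop}
    (hP : ∀ z ∈ U, ∃ r, 0 < r ∧ P z r) :
    ∃ τ, IsRadiusFamily N L τ ∧
      (∀ x ∈ U, ∃ s > 0, ∃ k₀, ∀ᶠ y in 𝓝 x, ∀ k ≥ k₀, s ≤ τ k y) ∧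
      ∀ k y, 0 < τ k y → ∃ z r, P z r ∧ N (y - z) < r ∧ τ k y ≤ r := by
  rcases U.eq_empty_or_nonempty with rfl | hU
  · exact ⟨fun _ _ => 0, ⟨fun _ => contDiff_const, fun _ _ => le_rfl, fun _ _ _ _ => le_rfl,
      fun _ _ v => by positivity⟩, by simp, by simp⟩
  choose! r hr hPr using hP
  obtain ⟨z, hz, hcov⟩ :=
    exists_countable_ball_cover hN.continuous hU fun z hz => half_pos (hr z hz)
  have hrz : ∀ i, 0 < r (z i) := fun i => hr _ (hz i)
  obtain ⟨c, hc1, hc⟩ := exists_abs_deriv_smoothTransition_le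
  set σ := min 1 (L / (4 * c))
  have hσ : 0 < σ := lt_min one_pos (by positivity)
  have hσL : σ * (4 * c) ≤ L := (le_div_iff₀ (by positivity)).1 (min_le_right _ _)
  have hτ := isRadiusFamily_bumpRadius (z := z) hσ hrz hN hC hc
  refine ⟨bumpRadius N σ z fun i => r (z i), ⟨hτ.contDiff, hτ.nonneg, hτ.mono, fun k y v => ?_⟩,
    fun x hx => ?_, fun k y hy => ?_⟩
  · exact (hτ.add_le k y v).trans (by gcongr)
  · obtain ⟨i, hi⟩ := hcov x hx
    exact ⟨_, mul_pos (by positivity) (mul_pos hσ (hrz i)), i + 1,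
      eventually_le_bumpRadius hσ hrz hN.continuous hi⟩
  · obtain ⟨i, hi⟩ := exists_bumpRadius_le hσ hrz (min_le_left _ _) hy
    exact ⟨z i, r (z i), hPr _ (hz i), hi⟩

end RadiusFamilies

section TameBalls

variable {E F : Type*} [NormedAddCommGroup E] [NormedSpace ℝ E] [NormedAddCommGroup F]
  [NormedSpace ℝ F] {N : Seminorm ℝ E} {b : SchauderBasis ℝ E} {f : E → F}

/-- On the `N`-ball of centre `z` and radius `2 * r`, the map `f` and its derivative vary by at most
`e`, and the derivative at `z` is `e`-small on the tails whose index `k` satisfies `2⁻ᵏ ≤ r`. -/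
structure IsTameBall (f : E → F) (N : Seminorm ℝ E) (b : SchauderBasis ℝ E) (z : E) (r e : ℝ) :
    Prop where
  radius_le : r ≤ e
  contDiffAt : ∀ y, N (y - z) < 2 * r → ContDiffAt ℝ 1 f y
  norm_apply_sub_le : ∀ y, N (y - z) < 2 * r → ‖f y - f z‖ ≤ e
  norm_fderiv_sub_le : ∀ y, N (y - z) < 2 * r → ‖fderiv ℝ f y - fderiv ℝ f z‖ ≤ e
  norm_comp_tailProj_le : ∀ k, (1 / 2 : ℝ) ^ k ≤ r → ‖(fderiv ℝ f z).comp (tailProj b k)‖ ≤ e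

theorem IsEquivalentNorm.eventually_forall_of_eventually_nhds (hN : IsEquivalentNorm N) {z : E}
    {p : E → Prop} (h : ∀ᶠ y in 𝓝 z, p y) :
    ∀ᶠ r in 𝓝[>] (0 : ℝ), ∀ y, N (y - z) < 2 * r → p y := by
  obtain ⟨c, _, hc, -, hcC⟩ := hN
  obtain ⟨ρ, hρ, hball⟩ := Metric.eventually_nhds_iff.1 h
  filter_upwards [mem_nhdsWithin_of_mem_nhds (Iio_mem_nhds (by positivity : 0 < c * ρ / 2))]
    with r hr y hy
  refine hball (lt_of_mul_lt_mul_left ?_ hc.le)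
  rw [dist_eq_norm]
  linarith [(hcC (y - z)).1, mem_Iio.1 hr]

theorem IsOneSuppressionUnconditional.eventually_isTameBall [CompleteSpace E]
    [FiniteDimensional ℝ F] (hb : IsOneSuppressionUnconditional N b) (hN : IsEquivalentNorm N)
    (hC : IsC1Norm N) {z : E} (hf : ContDiffAt ℝ 1 f z) {e : ℝ} (he : 0 < e) :
    ∀ᶠ r in 𝓝[>] 0, IsTameBall f N b z r e := by
  have hfz : ∀ᶠ y in 𝓝 z, ‖f y - f z‖ < e := by
    simpa [dist_eq_norm] using Metric.tendsto_nhds.1 hf.continuousAt e he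
  have hDfz : ∀ᶠ y in 𝓝 z, ‖fderiv ℝ f y - fderiv ℝ f z‖ < e := by
    simpa [dist_eq_norm] using
      Metric.tendsto_nhds.1 (hf.continuousAt_fderiv one_ne_zero) e he
  have htail : ∀ᶠ k in atTop, ‖(fderiv ℝ f z).comp (tailProj b k)‖ < e := by
    simpa using Metric.tendsto_nhds.1 (hb.tendsto_comp_tailProj hN hC (fderiv ℝ f z)) e he
  obtain ⟨k₀, hk₀⟩ := eventually_atTop.1 htail
  filter_upwards [hN.eventually_forall_of_eventually_nhds
      ((hf.eventually (by simp)).and (hfz.and hDfz)),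
    mem_nhdsWithin_of_mem_nhds (Iio_mem_nhds (lt_min he (by positivity : 0 < (1 / 2 : ℝ) ^ k₀)))]
    with r hball hr
  refine ⟨(hr.trans_le (min_le_left _ _)).le, fun y hy => (hball y hy).1,
    fun y hy => (hball y hy).2.1.le, fun y hy => (hball y hy).2.2.le, fun k hk => (hk₀ k ?_).le⟩
  exact ((pow_lt_pow_iff_right_of_lt_one₀ one_half_pos one_half_lt_one).1
    (hk.trans_lt (hr.trans_le (min_le_right _ _)))).le

end TameBalls

section Approximation

variable {E F : Type*} [NormedAddCommGroup E] [NormedSpace ℝ E] [NormedAddCommGroup F]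
  [NormedSpace ℝ F] {N : Seminorm ℝ E} {b : SchauderBasis ℝ E} {L : ℝ} {τ : ℕ → E → ℝ}
  {w : ℕ → F} {f : E → F}

/-- The map `f` precomposed with the `K`-th frozen sum and perturbed by the gated map. -/
noncomputable def approxMap (N : Seminorm ℝ E) (b : SchauderBasis ℝ E) (τ : ℕ → E → ℝ)
    (w : ℕ → F) (f : E → F) (K : ℕ) (x : E) : F :=
  f (frozenSum N b τ K x) + gatedMap N b τ w K x

namespace IsRadiusFamily

variable (hτ : IsRadiusFamily N L τ) (hN : IsEquivalentNorm N)
include hτ hN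

section Gluing

variable [CompleteSpace F] (hb : IsOneSuppressionUnconditional N b) (hw : ∀ j, ‖w j‖ ≤ 1)
include hb hw

theorem approxMap_eq_of_le {k l : ℕ} (hkl : k ≤ l) {x : E} (hk : 10 < radiusRatio N b τ k x) :
    approxMap N b τ w f l x = approxMap N b τ w f k x := by
  rw [approxMap, approxMap, hτ.gatedMap_eq hN hb hw hkl hk.le,
    hτ.frozenSum_eq hb hkl (by linarith)]

theorem approxMap_eq {k l : ℕ} {x : E} (hk : 10 < radiusRatio N b τ k x)
    (hl : 10 < radiusRatio N b τ l x) : approxMap N b τ w f l x = approxMap N b τ w f k x := by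
  rcases le_total k l with hkl | hlk
  · exact hτ.approxMap_eq_of_le hN hb hw hkl hk
  · exact (hτ.approxMap_eq_of_le hN hb hw hlk hl).symm

theorem exists_eventuallyEq_approxMap (hC : IsC1Norm N) (f : E → F) :
    ∃ g : E → F, ∀ K x, 10 < radiusRatio N b τ K x → g =ᶠ[𝓝 x] approxMap N b τ w f K := by
  classical
  refine ⟨fun x => if h : ∃ K, 10 < radiusRatio N b τ K x then
    approxMap N b τ w f (Nat.find h) x else 0, fun K x hx => ?_⟩
  filter_upwards [(hτ.contDiff_radiusRatio (b := b) hN hC K).continuous.continuousAt.eventually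
    (lt_mem_nhds hx)] with y hy
  rw [dif_pos ⟨K, hy⟩]
  exact hτ.approxMap_eq hN hb hw hy (Nat.find_spec (p := fun K => 10 < radiusRatio N b τ K y) _)

end Gluing

variable (hC : IsC1Norm N) {K : ℕ} {x : E} (hf : ContDiffAt ℝ 1 f (frozenSum N b τ K x))
include hC hf

theorem contDiffAt_approxMap : ContDiffAt ℝ 1 (approxMap N b τ w f K) x :=
  (hf.comp x (hτ.contDiff_frozenSum hN hC K).contDiffAt).add
    (hτ.contDiff_gatedMap hN hC K).contDiffAt

theorem fderiv_approxMap_apply (v : E) :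
    fderiv ℝ (approxMap N b τ w f K) x v =
      fderiv ℝ f (frozenSum N b τ K x) (fderiv ℝ (frozenSum N b τ K) x v)
        + fderiv ℝ (gatedMap N b τ w K) x v := by
  have hderiv : HasFDerivAt (approxMap N b τ w f K) _ x :=
    ((hf.differentiableAt one_ne_zero).hasFDerivAt.comp x
      (hτ.hasFDerivAt_frozenSum hN hC K x)).add
    ((hτ.contDiff_gatedMap hN hC K).differentiable one_ne_zero x).hasFDerivAt
  rw [hderiv.fderiv]
  rfl

theorem mem_coordSubspace_of_not_surjective [FiniteDimensional ℝ F]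
    (hb : IsOneSuppressionUnconditional N b) (hS : IsStrictlyConvexNorm N) (hw : ∀ j, ‖w j‖ ≤ 1)
    (htotal : ∀ φ : F →L[ℝ] ℝ, φ ≠ 0 → ∃ j ≥ K, φ (w j) ≠ 0) (hK : 2 ≤ radiusRatio N b τ K x)
    (hx : ¬ Function.Surjective (fderiv ℝ (approxMap N b τ w f K) x)) :
    x ∈ coordSubspace b {j | K ≤ j ∧ w j = 0} := by
  have : CompleteSpace F := FiniteDimensional.complete ℝ F
  have hrange : (fderiv ℝ (approxMap N b τ w f K) x).range < ⊤ :=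
    lt_top_iff_ne_top.2 fun h => hx (LinearMap.range_eq_top.1 h)
  obtain ⟨φ₀, hφ₀, hle⟩ := Submodule.exists_le_ker_of_lt_top _ hrange
  set φ : F →L[ℝ] ℝ := φ₀.toContinuousLinearMap
  have hφ : φ ≠ 0 := fun h => hφ₀ (LinearMap.ext fun v => DFunLike.congr_fun h v)
  obtain ⟨i, hi, hφi⟩ := htotal φ hφ
  refine mem_coordSubspace.2 fun j hj => hτ.coord_eq_zero_of_critical hb hN hC hS hw hK
    (ψ := φ.comp (fderiv ℝ f (frozenSum N b τ K x))) (fun v => ?_) hi hφi hj.1 hj.2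
  rw [ContinuousLinearMap.comp_apply, ← map_add, ← hτ.fderiv_approxMap_apply hN hC hf]
  exact hle ⟨v, rfl⟩

end IsRadiusFamily

theorem norm_le_of_seminorm_le {c₀ C₀ : ℝ} (hc₀ : 0 < c₀)
    (hN₀ : ∀ x, c₀ * ‖x‖ ≤ N x ∧ N x ≤ C₀ * ‖x‖) {M : ℝ} (hM : 0 ≤ M) {u v : E}
    (h : N u ≤ M * N v) : ‖u‖ ≤ M * (C₀ / c₀) * ‖v‖ :=
  calc ‖u‖ ≤ M * (C₀ * ‖v‖) / c₀ := by
        rw [le_div_iff₀' hc₀]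
        exact (hN₀ u).1.trans (h.trans (mul_le_mul_of_nonneg_left (hN₀ v).2 hM))
    _ = M * (C₀ / c₀) * ‖v‖ := by ring

section Close

variable {m K : ℕ} {x z : E} {r e : ℝ} (h : IsFirstDominated N b τ m x)
  (hm : τ m (b.proj m x) ≤ r) (hz : N (b.proj m x - z) < r)
include h hm hz

theorem IsFirstDominated.seminorm_sub_lt : N (x - z) < 2 * r := by
  have hsplit : x - z = tailProj b m x + (b.proj m x - z) := by rw [tailProj_apply]; abel
  rw [hsplit]
  linarith [map_add_le_add N (tailProj b m x) (b.proj m x - z), h.tailProj_le]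

variable (hb : IsOneSuppressionUnconditional N b) (hK : m ≤ K)
include hb hK

theorem IsFirstDominated.seminorm_frozenSum_sub_lt (hN : Continuous N) :
    N (frozenSum N b τ K x - z) < 2 * r := by
  have hsplit : frozenSum N b τ K x - z
      = (frozenSum N b τ K x - b.proj m x) + (b.proj m x - z) := by abel
  rw [hsplit]
  linarith [map_add_le_add N (frozenSum N b τ K x - b.proj m x) (b.proj m x - z),
    h.frozenSum_sub_le hb hN hK, h.tailProj_le]

variable [CompleteSpace F] (hball : IsTameBall f N b z r e) (hw : ∀ j, ‖w j‖ ≤ 1)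
include hball hw

theorem IsTameBall.norm_sub_approxMap_le (hN : IsEquivalentNorm N) :
    ‖f x - approxMap N b τ w f K x‖ ≤ 6 * e := by
  have hx := hball.norm_apply_sub_le x (h.seminorm_sub_lt hm hz)
  have hfrozen := hball.norm_apply_sub_le _ (h.seminorm_frozenSum_sub_lt hm hz hb hK hN.continuous)
  have hgated : ‖gatedMap N b τ w K x‖ ≤ 4 * e :=
    calc ‖gatedMap N b τ w K x‖ ≤ 4 * (1 / 2) ^ m * N (tailProj b m x) :=
          h.norm_gatedMap_le hb hN hw hK
      _ ≤ 4 * 1 * e := by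
          gcongr
          · exact pow_le_one₀ (by norm_num) (by norm_num)
          · exact h.tailProj_le.trans (hm.trans hball.radius_le)
      _ = 4 * e := by ring
  have hsplit : f x - approxMap N b τ w f K x
      = (f x - f z) - (f (frozenSum N b τ K x) - f z) - gatedMap N b τ w K x := by
    rw [approxMap]; abel
  rw [hsplit]
  linarith [norm_sub_le_of_le (norm_sub_le_of_le hx hfrozen) hgated]

theorem IsTameBall.norm_fderiv_sub_fderiv_approxMap_le {c₀ C₀ : ℝ} (hc₀ : 0 < c₀) (hC₀ : 0 < C₀)
    (hN₀ : ∀ x, c₀ * ‖x‖ ≤ N x ∧ N x ≤ C₀ * ‖x‖) (hτ : IsRadiusFamily N L τ) (hC : IsC1Norm N)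
    {c : ℝ} (hc1 : 1 ≤ c) (hc : ∀ s, |deriv Real.smoothTransition s| ≤ c) (hL0 : 0 ≤ L)
    (hL : 16 * c * L ≤ 1) :
    ‖fderiv ℝ f x - fderiv ℝ (approxMap N b τ w f K) x‖
      ≤ (2 + 68 * c * (C₀ / c₀) + 524 * c * C₀) * e := by
  have hN : IsEquivalentNorm N := ⟨c₀, C₀, hc₀, hC₀, hN₀⟩
  have hpow : (1 / 2 : ℝ) ^ m ≤ r := (half_pow_le_tailSize m x).trans (h.tailSize_le.trans hm)
  have he : 0 ≤ e := (by positivity : (0 : ℝ) ≤ (1 / 2) ^ m).trans (hpow.trans hball.radius_le)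
  have hx := h.seminorm_sub_lt hm hz
  have hy := h.seminorm_frozenSum_sub_lt hm hz hb hK hN.continuous
  refine ContinuousLinearMap.opNorm_le_bound _ (by positivity) fun v => ?_
  set y := frozenSum N b τ K x
  set A := fderiv ℝ f z
  set u := fderiv ℝ (frozenSum N b τ K) x v with hu
  have hunorm : ‖u‖ ≤ 34 * c * (C₀ / c₀) * ‖v‖ :=
    norm_le_of_seminorm_le hc₀ hN₀ (by positivity)
      (h.fderiv_frozenSum_le hτ hN hC hb hc1 hc hL0 hL K v)
  have hDx : ‖(fderiv ℝ f x - A) v‖ ≤ e * ‖v‖ :=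
    ContinuousLinearMap.le_of_opNorm_le _ (hball.norm_fderiv_sub_le x hx) v
  have hDy : ‖(fderiv ℝ f y - A) u‖ ≤ e * ‖u‖ :=
    ContinuousLinearMap.le_of_opNorm_le _ (hball.norm_fderiv_sub_le y hy) u
  -- `u - v` lies in the tail space of index `m`, on which `A` is small.
  have hAtail : ‖A (u - v)‖ ≤ e * (‖u‖ + ‖v‖) := by
    rw [hu, ← h.tailProj_fderiv_frozenSum_sub hτ hN hC hK v, ← hu]
    exact (ContinuousLinearMap.le_of_opNorm_le (A.comp (tailProj b m))
      (hball.norm_comp_tailProj_le m hpow) (u - v)).trans (by gcongr; exact norm_sub_le u v)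
  have hgated : ‖fderiv ℝ (gatedMap N b τ w K) x v‖ ≤ 524 * c * e * (C₀ * ‖v‖) :=
    (h.norm_fderiv_gatedMap_le hb hN hw hK hτ hC hc1 hc hL0 hL v).trans (by
      gcongr
      exacts [hpow.trans hball.radius_le, (hN₀ v).2])
  have hsplit : (fderiv ℝ f x - fderiv ℝ (approxMap N b τ w f K) x) v =
      (fderiv ℝ f x - A) v - (fderiv ℝ f y - A) u - A (u - v)
        - fderiv ℝ (gatedMap N b τ w K) x v := by
    rw [sub_apply, hτ.fderiv_approxMap_apply hN hC (hball.contDiffAt y hy), sub_apply, sub_apply,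
      map_sub]
    abel
  rw [hsplit]
  have htotal := norm_sub_le_of_le (norm_sub_le_of_le (norm_sub_le_of_le hDx hDy) hAtail) hgated
  linarith [mul_le_mul_of_nonneg_left hunorm he]

end Close

end Approximation

section RecurrentSequence

variable {F : Type*} [NormedAddCommGroup F] [NormedSpace ℝ F] [TopologicalSpace.SeparableSpace F]

theorem exists_total_sequence : ∃ u : ℕ → F, (∀ n, ‖u n‖ ≤ 1) ∧
    ∀ φ : F →L[ℝ] ℝ, φ ≠ 0 → ∃ n, φ (u n) ≠ 0 := by
  refine ⟨fun n => (1 + ‖TopologicalSpace.denseSeq F n‖)⁻¹ • TopologicalSpace.denseSeq F n,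
    fun n => ?_, fun φ hφ => ?_⟩
  · rw [norm_smul, norm_inv, Real.norm_of_nonneg (by positivity),
      inv_mul_le_one₀ (by positivity)]
    linarith
  · contrapose! hφ
    refine DFunLike.coe_injective ((TopologicalSpace.denseRange_denseSeq F).equalizer φ.continuous
      (0 : F →L[ℝ] ℝ).continuous (funext fun n => ?_))
    have hn := hφ n
    rw [map_smul, smul_eq_zero] at hn
    exact hn.resolve_left (by positivity)

theorem exists_recurrent_sequence : ∃ w : ℕ → F, (∀ j, ‖w j‖ ≤ 1) ∧
    (∀ K, {j | K ≤ j ∧ w j = 0}.Infinite) ∧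
    ∀ K, ∀ φ : F →L[ℝ] ℝ, φ ≠ 0 → ∃ j ≥ K, φ (w j) ≠ 0 := by
  obtain ⟨u, hu, htotal⟩ := exists_total_sequence (F := F)
  let v : ℕ → F := fun n => n.casesOn 0 u
  have hv : ∀ n, ‖v n‖ ≤ 1 := Nat.rec (by simp [v]) fun n _ => hu n
  refine ⟨fun j => v j.unpair.1, fun j => hv _, fun K => ?_, fun K φ hφ => ?_⟩
  · refine Set.infinite_of_forall_exists_gt fun n => ⟨Nat.pair 0 (max K (n + 1)), ⟨?_, ?_⟩, ?_⟩
    · exact (le_max_left _ _).trans (Nat.right_le_pair _ _)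
    · simp [v]
    · exact Nat.succ_le_iff.1 ((le_max_right _ _).trans (Nat.right_le_pair _ _))
  · obtain ⟨n, hn⟩ := htotal φ hφ
    exact ⟨Nat.pair (n + 1) K, Nat.right_le_pair _ _, by simpa [v] using hn⟩

end RecurrentSequence

section Construction

variable {E F : Type*} [NormedAddCommGroup E] [NormedSpace ℝ E] [CompleteSpace E]
  [NormedAddCommGroup F] [NormedSpace ℝ F] [FiniteDimensional ℝ F] {N : Seminorm ℝ E}
  {b : SchauderBasis ℝ E} {U : Set E} {f : E → F} {ε : E → ℝ}
  (hb : IsOneSuppressionUnconditional N b) (hN : IsEquivalentNorm N) (hC : IsC1Norm N)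
  (hU : IsOpen U) (hf : ContDiffOn ℝ 1 f U) (hε : LowerSemicontinuousOn ε U)
include hb hN hC hU hf hε

theorem exists_isTameBall_le {A : ℝ} (hA : 0 < A) {z : E} (hz : z ∈ U) (hεz : 0 < ε z) :
    ∃ r, 0 < r ∧ ∃ e, IsTameBall f N b z r e ∧ ∀ y, N (y - z) < 2 * r → A * e ≤ ε y := by
  have hlsc : ∀ᶠ y in 𝓝 z, ε z / 2 < ε y := by
    rw [← hU.nhdsWithin_eq hz]
    exact hε z hz _ (half_lt_self hεz)
  obtain ⟨r, hr, htame, hball⟩ := (eventually_mem_nhdsWithin.and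
    ((hb.eventually_isTameBall hN hC (hf.contDiffAt (hU.mem_nhds hz))
      (by positivity : 0 < ε z / 2 / A)).and
    (hN.eventually_forall_of_eventually_nhds hlsc))).exists
  exact ⟨r, hr, _, htame, fun y hy => (mul_div_cancel₀ _ hA.ne').trans_le (hball y hy).le⟩

theorem exists_approxMap (hε_pos : ∀ x ∈ U, 0 < ε x) {w : ℕ → F} (hw : ∀ j, ‖w j‖ ≤ 1) :
    ∃ L τ, IsRadiusFamily N L τ ∧ (∀ x ∈ U, ∃ K, 10 < radiusRatio N b τ K x) ∧
      ∀ x ∈ U, ∀ K, 10 < radiusRatio N b τ K x → ContDiffAt ℝ 1 f (frozenSum N b τ K x) ∧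
        ‖f x - approxMap N b τ w f K x‖ ≤ ε x ∧
        ‖fderiv ℝ f x - fderiv ℝ (approxMap N b τ w f K) x‖ ≤ ε x := by
  have := separableSpace_of_schauderBasis b
  have := UniformSpace.secondCountable_of_separable E
  have : CompleteSpace F := FiniteDimensional.complete ℝ F
  obtain ⟨c₀, C₀, hc₀, hC₀, hN₀⟩ := id hN
  obtain ⟨c, hc1, hc⟩ := exists_abs_deriv_smoothTransition_le
  set L := 1 / (16 * c)
  have hL0 : 0 < L := by positivity
  have hL : 16 * c * L ≤ 1 := (mul_one_div_cancel (by positivity)).le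
  set A := max 6 (2 + 68 * c * (C₀ / c₀) + 524 * c * C₀)
  have hA : 0 < A := lt_max_of_lt_left (by norm_num)
  obtain ⟨τ, hτ, hlower, hupper⟩ := exists_isRadiusFamily hN hC hL0 fun z hz =>
    exists_isTameBall_le hb hN hC hU hf hε hA hz (hε_pos z hz)
  have hfirst : ∀ x ∈ U, ∃ m, IsFirstDominated N b τ m x := fun x hx => by
    obtain ⟨s, hs, k₀, hk₀⟩ := hlower x hx
    exact exists_isFirstDominated hN.continuous hs hk₀
  refine ⟨L, τ, hτ, fun x hx => ?_, fun x hx K hK => ?_⟩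
  · obtain ⟨m, hm⟩ := hfirst x hx
    exact hm.exists_lt_radiusRatio hτ hb hN.continuous (by nlinarith) 10
  · obtain ⟨m, hm⟩ := hfirst x hx
    have hmK : m ≤ K := hm.le_of_one_le_radiusRatio (by linarith)
    obtain ⟨z, r, ⟨e, hball, hAe⟩, hz, hmr⟩ :=
      hupper m (b.proj m x) ((tailSize_pos m x).trans_le hm.tailSize_le)
    have he : 0 ≤ e := ((hτ.nonneg _ _).trans hmr).trans hball.radius_le
    have hεx := hAe x (hm.seminorm_sub_lt hmr hz)
    refine ⟨hball.contDiffAt _ (hm.seminorm_frozenSum_sub_lt hmr hz hb hmK hN.continuous), ?_, ?_⟩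
    · exact (hball.norm_sub_approxMap_le hm hmr hz hb hmK hw hN).trans
        ((mul_le_mul_of_nonneg_right (le_max_left _ _) he).trans hεx)
    · exact (hball.norm_fderiv_sub_fderiv_approxMap_le hm hmr hz hb hmK hw hc₀ hC₀ hN₀ hτ hC hc1
        hc hL0.le hL).trans ((mul_le_mul_of_nonneg_right (le_max_right _ _) he).trans hεx)

end Construction

theorem theorem3p2_general {E F : Type*} [NormedAddCommGroup E] [NormedSpace ℝ E]
    [CompleteSpace E] [NormedAddCommGroup F] [NormedSpace ℝ F] [FiniteDimensional ℝ F]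
    (N : Seminorm ℝ E) (hN : IsEquivalentNorm N) (hN_C1 : IsC1Norm N)
    (hN_conv : IsStrictlyConvexNorm N)
    (b : SchauderBasis ℝ E) (hb : IsOneSuppressionUnconditional N b)
    (U : Set E) (hU : IsOpen U) (f : E → F) (hf : ContDiffOn ℝ 1 f U)
    (ε : E → ℝ) (hε : LowerSemicontinuousOn ε U) (hε_pos : ∀ x ∈ U, 0 < ε x) :
    ∃ g : E → F, ContDiffOn ℝ 1 g U ∧
      (∀ x ∈ U, ‖f x - g x‖ ≤ ε x) ∧
      (∀ x ∈ U, ‖fderiv ℝ f x - fderiv ℝ g x‖ ≤ ε x) ∧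
      LocallyInFiniteUnionOfComplemented (criticalSet g U) := by
  have : CompleteSpace F := FiniteDimensional.complete ℝ F
  have : ProperSpace F := FiniteDimensional.proper_real F
  obtain ⟨w, hw, hzero, htotal⟩ := exists_recurrent_sequence (F := F)
  obtain ⟨L, τ, hτ, hlarge, hclose⟩ := exists_approxMap hb hN hN_C1 hU hf hε hε_pos hw
  obtain ⟨g, hg⟩ := hτ.exists_eventuallyEq_approxMap hN hb hw hN_C1 f
  choose! κ hκ using hlarge
  refine ⟨g, fun x hx => ?_, fun x hx => ?_, fun x hx => ?_, fun x hx => ?_⟩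
  · exact ((hτ.contDiffAt_approxMap hN hN_C1 (hclose x hx _ (hκ x hx)).1).congr_of_eventuallyEq
      (hg _ x (hκ x hx))).contDiffWithinAt
  · rw [(hg _ x (hκ x hx)).eq_of_nhds]
    exact (hclose x hx _ (hκ x hx)).2.1
  · rw [(hg _ x (hκ x hx)).fderiv_eq]
    exact (hclose x hx _ (hκ x hx)).2.2
  · have hcompl := closedComplemented_coordSubspace (A := {j | κ x ≤ j ∧ w j = 0}) hb hN
    refine ⟨{y | 10 < radiusRatio N b τ (κ x) y}, isOpen_lt continuous_const
      (hτ.contDiff_radiusRatio hN hN_C1 _).continuous, hκ x hx.1, 1,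
      fun _ => coordSubspace b {j | κ x ≤ j ∧ w j = 0},
      fun _ => ⟨hcompl.isClosed, hcompl, not_finiteDimensional_quotient_coordSubspace (hzero _)⟩,
      fun y ⟨⟨hyU, hy⟩, hyK⟩ => mem_iUnion.2 ⟨0, ?_⟩⟩
    rw [(hg _ y hyK).fderiv_eq] at hy
    exact hτ.mem_coordSubspace_of_not_surjective hN hN_C1 (hclose y hyU _ hyK).1 hb hN_conv hw
      (htotal _) ((by norm_num : (2 : ℝ) ≤ 10).trans (le_of_lt hyK)) hy

theorem theorem3p2 {E : Type*} [NormedAddCommGroup E] [NormedSpace ℝ E] [CompleteSpace E]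
    (hE : ¬ FiniteDimensional ℝ E)
    (N : Seminorm ℝ E) (hN : IsEquivalentNorm N) (hN_C1 : IsC1Norm N)
    (hN_conv : IsStrictlyConvexNorm N)
    (b : SchauderBasis ℝ E) (hb : IsOneSuppressionUnconditional N b)
    (d : ℕ) (U : Set E) (hU : IsOpen U)
    (f : E → EuclideanSpace ℝ (Fin d)) (hf : ContDiffOn ℝ 1 f U)
    (ε : E → ℝ) (hε : ContinuousOn ε U) (hε_pos : ∀ x ∈ U, 0 < ε x) :
    ∃ g : E → EuclideanSpace ℝ (Fin d), ContDiffOn ℝ 1 g U ∧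
      (∀ x ∈ U, ‖f x - g x‖ ≤ ε x) ∧
      (∀ x ∈ U, ‖fderiv ℝ f x - fderiv ℝ g x‖ ≤ ε x) ∧
      LocallyInFiniteUnionOfComplemented (criticalSet g U) :=
  theorem3p2_general N hN hN_C1 hN_conv b hb U hU f hf ε hε.lowerSemicontinuousOn hε_pos
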